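/- Let $p$ be a prime number and let $G$ be a free pro-$p$ group on a set converging to $1$. Let $C^\bullet(G,\mathbb{F}_p)$ be the differential graded $\mathbb{F}_p$-algebra of continuous inhomogeneous cochains of $G$, whose multiplication is the cup product $(\varphi\cup\psi)(g_1,\ldots,g_{m+n})=\varphi(g_1,\ldots,g_m)\,\psi(g_{m+1},\ldots,g_{m+n})$, and let $H^\bullet(G,\mathbb{F}_p)$ be its cohomology algebra. For $N=3$ or $N=\infty$, a differential graded algebra $\mathcal{A}$ over a field (unital, associative, $\mathbb{Z}$-graded, with differential of degree $+1$) is called $A_N$-formal if, regarded as an $A_N$-algebra with $m_1=d$, $m_2$ the multiplication and $m_n=0$ for $n\ge 3$, it has a minimal model with vanishing higher operations: there are an $A_N$-algebra $\mathcal{H}$ with $m_1=0$ and $m_n=0$ for all $n$ with $3\le n\le N$, and a morphism of $A_N$-algebras $f\colon\mathcal{H}\to\mathcal{A}$ for which $f_1$ induces an isomorphism on cohomology. Here an $A_N$-algebra is a graded vector space with operations $m_n$ of degree $2-n$, and a morphism consists of maps $f_n$ of degree $1-n$ ($1\le n\le N$), that satisfy for all $n\le N$ the relations $$\sum_{r+s+t=n,\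 s\ge 1}(-1)^{r+st}\,m_{r+1+t}(1^{\otimes r}\otimes m_s\otimes 1^{\otimes t})=0,$$ $$\sum_{r+s+t=n,\ s\ge 1}(-1)^{r+st}\,f_{r+1+t}(1^{\otimes r}\otimes m_s\otimes 1^{\otimes t})=\sum_{i_1+\cdots+i_q=n}(-1)^{\sum_{j=1}^{q}(q-j)(i_j-1)}\,m_q(f_{i_1}\otimes\cdots\otimes f_{i_q}),$$ with the Koszul sign rule. Then: 1. The graded $\mathbb{F}_p$-algebra $H^\bullet(G,\mathbb{F}_p)$ is intrinsically $A_\infty$-formal, that is, every differential graded $\mathbb{F}_p$-algebra whose cohomology algebra is isomorphic to $H^\bullet(G,\mathbb{F}_p)$ as a graded algebra is $A_\infty$-formal. 2. In particular, $G$ is $A_3$-formal with respect to $p$, that is, $C^\bullet(G,\mathbb{F}_p)$ is $A_3$-formal. -/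

import Mathlib

universe u v w

/-- A `ℤ`-graded associative unital algebra over a field. -/
structure GradedAlg (k : Type u) [Field k] where
  carrier : Type v
  [ring : Ring carrier]
  [algebra : Algebra k carrier]
  grading : ℤ → Submodule k carrier
  [gradedMonoid : SetLike.GradedMonoid grading]
  isInternal : DirectSum.IsInternal grading

attribute [instance] GradedAlg.ring GradedAlg.algebra GradedAlg.gradedMonoid

/-- An isomorphism of graded algebras: an algebra isomorphism that identifies the homogeneous
components of each degree. -/
structure GradedAlg.Iso {k : Type u} [Field k] (H : GradedAlg.{u, v} k) (K : GradedAlg.{u, w} k) where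
  toAlgEquiv : H.carrier ≃ₐ[k] K.carrier
  mem_iff : ∀ (i : ℤ) (x : H.carrier), toAlgEquiv x ∈ K.grading i ↔ x ∈ H.grading i

/-- A differential graded algebra over a field, with cohomological (`ℤ`-)grading:
the differential has degree `+1`, squares to zero and satisfies
`d (x y) = (d x) y + (-1)^|x| x (d y)`. -/
structure DGAlg (k : Type u) [Field k] extends GradedAlg.{u, v} k where
  d : carrier →ₗ[k] carrier
  d_mem : ∀ {i : ℤ} {x : carrier}, x ∈ grading i → d x ∈ grading (i + 1)
  d_d : ∀ x : carrier, d (d x) = 0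
  leibniz : ∀ {i : ℤ} {x : carrier}, x ∈ grading i → ∀ y : carrier,
    d (x * y) = d x * y + i.negOnePow • (x * d y)

namespace DGAlg

variable {k : Type u} [Field k] (A : DGAlg.{u, v} k)

theorem hom_induction {P : A.carrier → Prop} (x : A.carrier)
    (mem : ∀ i, ∀ x ∈ A.grading i, P x) (add : ∀ x y, P x → P y → P (x + y)) : P x := by
  have hx : x ∈ ⨆ i, A.grading i := by
    rw [A.isInternal.submodule_iSup_eq_top]; trivial
  induction hx using Submodule.iSup_induction' with
  | mem i x hx => exact mem i x hx
  | zero => exact mem 0 0 (zero_mem _)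
  | add x y _ _ hx hy => exact add x y hx hy

/-- The projection onto the homogeneous component of degree `i`. -/
noncomputable def proj (i : ℤ) : A.carrier →ₗ[k] A.carrier :=
  letI := A.isInternal.gradedAlgebra
  GradedAlgebra.proj A.grading i

theorem proj_mem (i : ℤ) (x : A.carrier) : A.proj i x ∈ A.grading i := by
  simp [proj, GradedAlgebra.proj_apply]

theorem proj_same {i : ℤ} {x : A.carrier} (hx : x ∈ A.grading i) : A.proj i x = x := by
  let _ := A.isInternal.gradedAlgebra
  exact DirectSum.decompose_of_mem_same A.grading hx

theorem proj_ne {i j : ℤ} (hij : j ≠ i) {x : A.carrier} (hx : x ∈ A.grading j) :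
    A.proj i x = 0 := by
  let _ := A.isInternal.gradedAlgebra
  exact DirectSum.decompose_of_mem_ne A.grading hx hij

theorem proj_d (i : ℤ) (x : A.carrier) : A.proj (i + 1) (A.d x) = A.d (A.proj i x) := by
  induction x using A.hom_induction with
  | mem j x hx =>
    by_cases h : j = i
    · subst h; rw [A.proj_same hx, A.proj_same (A.d_mem hx)]
    · rw [A.proj_ne h hx, A.proj_ne (by omega) (A.d_mem hx), map_zero]
  | add x y hx hy => simp [hx, hy]

theorem eq_sum_proj (x : A.carrier) : ∃ s : Finset ℤ, x = ∑ i ∈ s, A.proj i x := by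
  classical
  let _ := A.isInternal.gradedAlgebra
  exact ⟨_, (DirectSum.sum_support_decompose A.grading x).symm⟩

theorem d_one : A.d 1 = 0 := by
  have h := A.leibniz (SetLike.GradedOne.one_mem (A := A.grading)) 1
  simpa using h

theorem d_mul_of_cocycle {x : A.carrier} (y : A.carrier) (hy : A.d y = 0) :
    A.d (x * y) = A.d x * y := by
  induction x using A.hom_induction with
  | mem j x hx => simp [A.leibniz hx, hy]
  | add x x' hx hx' => simp [add_mul, hx, hx']

theorem mul_d_of_cocycle {x : A.carrier} (hx : A.d x = 0) (y : A.carrier) :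
    ∃ z, A.d z = x * A.d y := by
  obtain ⟨s, hs⟩ := A.eq_sum_proj x
  have h0 : ∀ i, A.d (A.proj i x) = 0 := fun i => by rw [← A.proj_d, hx, map_zero]
  refine ⟨∑ i ∈ s, i.negOnePow • (A.proj i x * y), ?_⟩
  conv_rhs => rw [hs, Finset.sum_mul]
  rw [map_sum]
  refine Finset.sum_congr rfl fun i _ => ?_
  have : A.d (i.negOnePow • (A.proj i x * y)) = i.negOnePow • A.d (A.proj i x * y) := by
    rcases Int.even_or_odd i with h | h
    · simp [Int.negOnePow_even i h]
    · simp [Int.negOnePow_odd i h]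
  rw [this, A.leibniz (A.proj_mem i x), h0]
  rcases Int.even_or_odd i with h | h
  · simp [Int.negOnePow_even i h]
  · simp [Int.negOnePow_odd i h]

/-- The subalgebra of cocycles, `ker d`. -/
def cocycles : Subalgebra k A.carrier where
  carrier := {x | A.d x = 0}
  mul_mem' {x y} hx hy := by
    simp only [Set.mem_ofPred_eq] at *
    rw [A.d_mul_of_cocycle y hy, hx, zero_mul]
  add_mem' {x y} hx hy := by
    simp only [Set.mem_ofPred_eq] at *
    rw [map_add, hx, hy, add_zero]
  algebraMap_mem' r := by
    simp [Algebra.algebraMap_eq_smul_one, A.d_one]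

/-- The two-sided ideal of coboundaries, `im d`, in the algebra of cocycles. -/
def coboundaries : Ideal A.cocycles where
  carrier := {x | ∃ y, A.d y = x}
  add_mem' := by
    rintro x y ⟨a, ha⟩ ⟨b, hb⟩
    exact ⟨a + b, by simp [ha, hb]⟩
  zero_mem' := ⟨0, by simp⟩
  smul_mem' := by
    rintro c x ⟨a, ha⟩
    obtain ⟨z, hz⟩ := A.mul_d_of_cocycle c.2 a
    exact ⟨z, by simp [hz, ha]⟩

instance : A.coboundaries.IsTwoSided where
  mul_mem_of_left := by
    rintro x y ⟨a, ha⟩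
    exact ⟨a * y, by rw [A.d_mul_of_cocycle _ y.2, ha]; rfl⟩

/-- The projection from cocycles to cohomology classes. -/
def classMap : A.cocycles →ₐ[k] A.cocycles ⧸ A.coboundaries :=
  Ideal.Quotient.mkₐ k A.coboundaries

/-- The homogeneous cocycles of degree `i`. -/
def cocyclesGrading (i : ℤ) : Submodule k A.cocycles :=
  (A.grading i).comap A.cocycles.val.toLinearMap

/-- The cohomology classes of degree `i`: those that are represented by cocycles of degree `i`. -/
def cohomologyGrading (i : ℤ) : Submodule k (A.cocycles ⧸ A.coboundaries) :=
  (A.cocyclesGrading i).map A.classMap.toLinearMap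

instance : SetLike.GradedMonoid A.cohomologyGrading where
  one_mem := ⟨1, SetLike.GradedOne.one_mem (A := A.grading), map_one A.classMap⟩
  mul_mem := by
    rintro i j _ _ ⟨x, hx, rfl⟩ ⟨y, hy, rfl⟩
    exact ⟨x * y, SetLike.GradedMul.mul_mem (A := A.grading) hx hy, map_mul A.classMap x y⟩

theorem cohomology_isInternal : DirectSum.IsInternal A.cohomologyGrading := by
  rw [DirectSum.isInternal_submodule_iff_iSupIndep_and_iSup_eq_top]
  constructor
  · intro i
    rw [Submodule.disjoint_def]
    rintro _ ⟨z, hz, rfl⟩ h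
    simp only [cohomologyGrading, ← Submodule.map_iSup] at h
    obtain ⟨w, hw, hwz⟩ := h
    have hw0 : A.proj i w = 0 := by
      have hle : (⨆ j, ⨆ (_ : j ≠ i), A.cocyclesGrading j) ≤
          LinearMap.ker ((A.proj i).comp A.cocycles.val.toLinearMap) := by
        refine iSup_le fun j => iSup_le fun hj y hy => ?_
        exact A.proj_ne hj hy
      exact hle hw
    have hd : w - z ∈ A.coboundaries := (Ideal.Quotient.eq (I := A.coboundaries)).1 hwz
    obtain ⟨y, hy⟩ := hd
    have hz' : A.proj i z = z := A.proj_same hz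
    have key : A.d (A.proj (i - 1) (-y)) = z := by
      rw [← A.proj_d, sub_add_cancel, map_neg, hy]
      simp [hw0, hz']
    exact (Ideal.Quotient.eq_zero_iff_mem (I := A.coboundaries)).2 ⟨_, key⟩
  · rw [eq_top_iff]
    rintro x -
    obtain ⟨z, rfl⟩ := Ideal.Quotient.mk_surjective x
    obtain ⟨s, hs⟩ := A.eq_sum_proj z
    have h0 : ∀ i, A.d (A.proj i z) = 0 := fun i => by
      rw [← A.proj_d, show A.d z = 0 from z.2, map_zero]
    have hz : z = ∑ i ∈ s, (⟨A.proj i z, h0 i⟩ : A.cocycles) := by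
      apply Subtype.ext
      rw [AddSubmonoidClass.coe_finsetSum]
      exact hs
    rw [hz, map_sum]
    refine Submodule.sum_mem _ fun i _ => ?_
    exact Submodule.mem_iSup_of_mem i ⟨⟨A.proj i z, h0 i⟩, A.proj_mem i z, rfl⟩

/-- The cohomology algebra `ker d / im d` of a differential graded algebra, as a graded algebra. -/
def cohomology : GradedAlg.{u, v} k where
  carrier := A.cocycles ⧸ A.coboundaries
  grading := A.cohomologyGrading
  isInternal := A.cohomology_isInternal

end DGAlg

section AInfinity

open Finset

variable {k : Type u} [Field k]

/-- Families of `n`-ary operations `A^{⊗ n} → B`, one for each arity `n`. Only arities `n ≥ 1` are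
ever used. -/
abbrev Operations (k : Type u) [Field k] (A : Type v) (B : Type w) [AddCommGroup A] [Module k A]
    [AddCommGroup B] [Module k B] : Type (max v w) :=
  (n : ℕ) → MultilinearMap k (fun _ : Fin n => A) B

/-- The `n`-th operation raises the degree by `c - n`, for every `n ≥ 1` with `n ≤ N`. -/
def Operations.HasDegree {A : Type v} {B : Type w} [AddCommGroup A] [Module k A]
    [AddCommGroup B] [Module k B] (f : Operations k A B) (𝒜 : ℤ → Submodule k A)
    (ℬ : ℤ → Submodule k B) (c : ℤ) (N : ℕ∞) : Prop :=
  ∀ n : ℕ, 1 ≤ n → (n : ℕ∞) ≤ N → ∀ (e : Fin n → ℤ) (x : Fin n → A),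
    (∀ i, x i ∈ 𝒜 (e i)) → f n x ∈ ℬ (∑ i, e i + (c - n))

/-- The sequence `x_0, …, x_{r-1}, y, x_{r+s}, x_{r+s+1}, …`, in which the `s` terms
`x_r, …, x_{r+s-1}` have been replaced by the single term `y`. -/
def splice {A : Type v} (r s : ℕ) (y : A) (x : ℕ → A) (j : ℕ) : A :=
  if j < r then x j else if j = r then y else x (j - 1 + s)

/-- The value at `x_0 ⊗ ⋯ ⊗ x_{n-1}`, where `x_i` is homogeneous of degree `e i`, of
`∑ (-1)^{r + s t} f_{r+1+t} (1^{⊗ r} ⊗ m_s ⊗ 1^{⊗ t})`, the sum being over all decompositions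
`n = r + s + t` with `s ≥ 1` and `r, t ≥ 0`, and `m_s` being of degree `2 - s`.
The Koszul sign rule gives the additional sign `(-1)^{(2 - s) (e 0 + ⋯ + e (r-1))}`. -/
def insertionSum {A : Type v} {B : Type w} [AddCommGroup A] [Module k A]
    [AddCommGroup B] [Module k B] (f : Operations k A B) (m : Operations k A A)
    (n : ℕ) (e : ℕ → ℤ) (x : ℕ → A) : B :=
  ∑ r ∈ range n, ∑ s ∈ Icc 1 (n - r), let t := n - r - s
    ((r : ℤ) + s * t + (2 - s) * ∑ i ∈ range r, e i).negOnePow •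
      f (r + 1 + t) fun j => splice r s (m s fun i => x (r + i)) x j

/-- The value at `x_0 ⊗ ⋯ ⊗ x_{n-1}`, where `x_i` is homogeneous of degree `e i`, of
`∑ (-1)^σ m_q (f_{i_1} ⊗ ⋯ ⊗ f_{i_q})`, the sum being over all `q ≥ 1` and all decompositions
`n = i_1 + ⋯ + i_q` with all `i_j ≥ 1`, where `f_i` is of degree `1 - i` and
`σ = (q - 1) (i_1 - 1) + (q - 2) (i_2 - 1) + ⋯ + (i_{q-1} - 1)`.
The Koszul sign rule gives, for every `j`, the additional sign `(-1)^{(1 - i_j) E_j}`, where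
`E_j` is the total degree of the arguments that stand before those of `f_{i_j}`. -/
def compositionSum {A : Type v} {B : Type w} [AddCommGroup A] [Module k A]
    [AddCommGroup B] [Module k B] (m : Operations k B B) (f : Operations k A B)
    (n : ℕ) (e : ℕ → ℤ) (x : ℕ → A) : B :=
  ∑ c : Composition n,
    (∑ j : Fin c.length, (((c.length : ℤ) - 1 - (j : ℕ)) * ((c.blocksFun j : ℤ) - 1) +
        (1 - (c.blocksFun j : ℤ)) * ∑ i ∈ range (c.sizeUpTo j), e i)).negOnePow •
      m c.length fun j => f (c.blocksFun j) fun i => x (c.sizeUpTo j + i)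

/-- An `A_N`-algebra over the field `k`, for `1 ≤ N ≤ ∞`: a graded vector space with operations `m_n` of
degree `2 - n` for `1 ≤ n ≤ N` that satisfy, for `1 ≤ n ≤ N`, the relation
`∑_{r+s+t=n} (-1)^{r + s t} m_{r+1+t} (1^{⊗ r} ⊗ m_s ⊗ 1^{⊗ t}) = 0`.
For `N = ∞` these are the `A_∞`-algebras. The operations `m_n` with `n = 0` or `n > N` are not part
of the structure: nothing is required of them, and nothing refers to them. -/
structure AnAlg (N : ℕ∞) (k : Type u) [Field k] where
  carrier : Type v
  [addCommGroup : AddCommGroup carrier]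
  [module : Module k carrier]
  grading : ℤ → Submodule k carrier
  isInternal : DirectSum.IsInternal grading
  m : Operations k carrier carrier
  hasDegree : m.HasDegree grading grading 2 N
  relation : ∀ n : ℕ, 1 ≤ n → (n : ℕ∞) ≤ N → ∀ (e : ℕ → ℤ) (x : ℕ → carrier),
    (∀ i, x i ∈ grading (e i)) → insertionSum m m n e x = 0

attribute [instance] AnAlg.addCommGroup AnAlg.module

/-- The operation `m_1`, as a linear map. -/
def AnAlg.m₁ {N : ℕ∞} (A : AnAlg.{u, v} N k) : A.carrier →ₗ[k] A.carrier where
  toFun x := A.m 1 fun _ => x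
  map_add' x y := by
    have h (z : A.carrier) : Function.update (fun _ : Fin 1 => (0 : A.carrier)) 0 z = fun _ => z := by
      ext i; simp [Subsingleton.elim i 0]
    simpa only [h] using (A.m 1).map_update_add (fun _ => 0) 0 x y
  map_smul' c x := by
    have h (z : A.carrier) : Function.update (fun _ : Fin 1 => (0 : A.carrier)) 0 z = fun _ => z := by
      ext i; simp [Subsingleton.elim i 0]
    simpa only [h, RingHom.id_apply] using (A.m 1).map_update_smul (fun _ => 0) 0 c x

/-- A morphism `f : A → B` of `A_N`-algebras: operations `f_n : A^{⊗ n} → B` of degree `1 - n` for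
`1 ≤ n ≤ N` that satisfy, for `1 ≤ n ≤ N`, the relation
`∑_{r+s+t=n} (-1)^{r + s t} f_{r+1+t} (1^{⊗ r} ⊗ m_s ⊗ 1^{⊗ t})
  = ∑_{i_1+⋯+i_q=n} (-1)^σ m_q (f_{i_1} ⊗ ⋯ ⊗ f_{i_q})`. -/
structure AnHom {N : ℕ∞} (A : AnAlg.{u, v} N k) (B : AnAlg.{u, w} N k) where
  f : Operations k A.carrier B.carrier
  hasDegree : f.HasDegree A.grading B.grading 1 N
  relation : ∀ n : ℕ, 1 ≤ n → (n : ℕ∞) ≤ N → ∀ (e : ℕ → ℤ) (x : ℕ → A.carrier),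
    (∀ i, x i ∈ A.grading (e i)) →
      insertionSum f A.m n e x = compositionSum B.m f n e x

/-- A morphism of `A_N`-algebras is a quasi-isomorphism if the map of complexes `f_1` induces an
injective and surjective map `ker m_1 / im m_1 → ker m_1 / im m_1` on cohomology. -/
def AnHom.IsQuasiIso {N : ℕ∞} {A : AnAlg.{u, v} N k} {B : AnAlg.{u, w} N k} (f : AnHom A B) :
    Prop :=
  (∀ x, A.m₁ x = 0 → (∃ y, B.m₁ y = f.f 1 fun _ => x) → ∃ z, A.m₁ z = x) ∧
  (∀ y, B.m₁ y = 0 → ∃ x z, A.m₁ x = 0 ∧ y = (f.f 1 fun _ => x) + B.m₁ z)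

/-- A minimal model of an `A_N`-algebra `A`: an `A_N`-algebra with `m_1 = 0` together with a
quasi-isomorphism to `A`. -/
structure MinimalModel {N : ℕ∞} (A : AnAlg.{u, v} N k) where
  alg : AnAlg.{u, v} N k
  minimal : alg.m 1 = 0
  hom : AnHom alg A
  isQuasiIso : hom.IsQuasiIso

/-- The operations of a differential graded algebra: `m_1 = d`, `m_2` is the multiplication and
all other operations vanish. -/
def DGAlg.operations (A : DGAlg.{u, v} k) : Operations k A.carrier A.carrier
  | 1 => A.d.compMultilinearMap (MultilinearMap.mkPiAlgebraFin k 1 A.carrier)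
  | 2 => MultilinearMap.mkPiAlgebraFin k 2 A.carrier
  | _ => 0

namespace DGAlg

variable (A : DGAlg.{u, v} k)

theorem operations_one (x : Fin 1 → A.carrier) : A.operations 1 x = A.d (x 0) := by
  have h : A.operations 1 x = A.d (List.ofFn x).prod := rfl
  simp [h]

theorem operations_two (x : Fin 2 → A.carrier) : A.operations 2 x = x 0 * x 1 := by
  have h : A.operations 2 x = (List.ofFn x).prod := rfl
  simp [h]

theorem operations_of_three_le {n : ℕ} (hn : 3 ≤ n) : A.operations n = 0 := by
  match n, hn with
  | n + 3, _ => rfl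

theorem operations_hasDegree (N : ℕ∞) :
    A.operations.HasDegree A.grading A.grading 2 N := by
  intro n hn _ e x hx
  match n, hn with
  | 1, _ =>
    rw [operations_one]
    simpa using A.d_mem (hx 0)
  | 2, _ =>
    rw [operations_two]
    simpa [Fin.sum_univ_two] using SetLike.GradedMul.mul_mem (A := A.grading) (hx 0) (hx 1)
  | n + 3, _ => exact zero_mem _

theorem operations_relation (n : ℕ) (hn : 1 ≤ n) (e : ℕ → ℤ) (x : ℕ → A.carrier)
    (hx : ∀ i, x i ∈ A.grading (e i)) :
    insertionSum A.operations A.operations n e x = 0 := by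
  match n, hn with
  | 1, _ =>
    simp [insertionSum, splice, operations_one, A.d_d]
  | 2, _ =>
    simp [insertionSum, splice, Finset.sum_range_succ, Finset.sum_Icc_succ_top,
      operations_one, operations_two, A.leibniz (hx 0),
      Int.negOnePow_add]
  | 3, _ =>
    simp [insertionSum, splice, Finset.sum_range_succ, Finset.sum_Icc_succ_top,
      operations_one, operations_two, operations_of_three_le,
      Int.negOnePow_even 2 even_two, mul_assoc]
  | n + 4, _ =>
    refine Finset.sum_eq_zero fun r hr => Finset.sum_eq_zero fun s hs => ?_
    dsimp only
    rw [Finset.mem_range] at hr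
    rw [Finset.mem_Icc] at hs
    by_cases h : 3 ≤ r + 1 + (n + 4 - r - s)
    · simp [A.operations_of_three_le h]
    · have hs3 : 3 ≤ s := by omega
      have hy : ∃ j : Fin (r + 1 + (n + 4 - r - s)), (j : ℕ) = r := ⟨⟨r, by omega⟩, rfl⟩
      obtain ⟨j, hj⟩ := hy
      rw [(A.operations _).map_coord_zero j
        (by simp [splice, hj, A.operations_of_three_le hs3]), smul_zero]

/-- A differential graded algebra, regarded as an `A_N`-algebra. -/
def toAnAlg (N : ℕ∞) : AnAlg.{u, v} N k where
  carrier := A.carrier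
  grading := A.grading
  isInternal := A.isInternal
  m := A.operations
  hasDegree := A.operations_hasDegree N
  relation n hn _ := A.operations_relation n hn

/-- A differential graded algebra is `A_N`-formal (for `3 ≤ N ≤ ∞`) if it has a minimal model, as an
`A_N`-algebra, in which all operations `m_n` with `n ≥ 3` vanish. -/
def IsFormal (N : ℕ∞) : Prop :=
  ∃ M : MinimalModel (A.toAnAlg N), ∀ n : ℕ, 3 ≤ n → (n : ℕ∞) ≤ N → M.alg.m n = 0

end DGAlg

end AInfinity

/-- A graded algebra `H` is intrinsically `A_∞`-formal if every differential graded algebra whose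
cohomology algebra is isomorphic to `H` as a graded algebra is `A_∞`-formal. -/
def GradedAlg.IsIntrinsicallyFormal {k : Type u} [Field k] (H : GradedAlg.{u, v} k) : Prop :=
  ∀ B : DGAlg.{u, w} k, Nonempty (B.cohomology.Iso H) → B.IsFormal ⊤

section GroupCohomology

set_option linter.unusedSectionVars false

open DirectSum Finset

variable (p : ℕ) (G : Type u) [Group G] [TopologicalSpace G]

/-- Continuous inhomogeneous `n`-cochains: continuous functions `G^n → 𝔽_p`, where `𝔽_p` is
discrete. -/
abbrev Cochain (n : ℕ) : Type u := C(Fin n → G, ZMod p)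

variable {p G}

/-- The cup product of cochains:
`(φ ∪ ψ)(g_1, …, g_{m+n}) = φ(g_1, …, g_m) ψ(g_{m+1}, …, g_{m+n})`. -/
def Cochain.cup {m n : ℕ} (φ : Cochain p G m) (ψ : Cochain p G n) : Cochain p G (m + n) where
  toFun g := φ (fun i => g (Fin.castAdd n i)) * ψ (fun i => g (Fin.natAdd m i))
  continuous_toFun := by fun_prop

/-- The value of an `n`-cochain on the first `n` terms of a sequence in `G`. -/
def Cochain.ev {n : ℕ} (φ : Cochain p G n) (g : ℕ → G) : ZMod p := φ fun i => g i

theorem Cochain.ext_ev {n : ℕ} {φ ψ : Cochain p G n} (h : ∀ g, φ.ev g = ψ.ev g) : φ = ψ := by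
  ext g
  have := h fun i => if hi : i < n then g ⟨i, hi⟩ else 1
  simpa [Cochain.ev] using this

theorem Cochain.mk_eq_mk {m n : ℕ} {φ : Cochain p G m} {ψ : Cochain p G n} (hmn : m = n)
    (h : ∀ g, φ.ev g = ψ.ev g) :
    (GradedMonoid.mk m φ : GradedMonoid (Cochain p G)) = GradedMonoid.mk n ψ := by
  subst hmn
  rw [Cochain.ext_ev h]

theorem Cochain.ev_cup {m n : ℕ} (φ : Cochain p G m) (ψ : Cochain p G n) (g : ℕ → G) :
    (φ.cup ψ).ev g = φ.ev g * ψ.ev fun i => g (m + i) := rfl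

instance : GradedMonoid.GMul (Cochain p G) where
  mul φ ψ := φ.cup ψ

instance : GradedMonoid.GOne (Cochain p G) where
  one := ContinuousMap.const _ 1

theorem Cochain.ev_mul {m n : ℕ} (φ : Cochain p G m) (ψ : Cochain p G n) (g : ℕ → G) :
    Cochain.ev (n := m + n) (GradedMonoid.GMul.mul φ ψ) g = φ.ev g * ψ.ev fun i => g (m + i) := rfl

theorem Cochain.ev_one (g : ℕ → G) :
    Cochain.ev (n := 0) (GradedMonoid.GOne.one : Cochain p G 0) g = 1 := rfl

/-- The cup product makes the family of all `C^n(G, 𝔽_p)` a graded ring. -/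
instance : DirectSum.GRing (Cochain p G) where
  one_mul a := Cochain.mk_eq_mk (zero_add _) fun g => by
    simp [Cochain.ev_mul, Cochain.ev_one]
  mul_one a := Cochain.mk_eq_mk (add_zero _) fun g => by
    simp [Cochain.ev_mul, Cochain.ev_one]
  mul_assoc a b c := Cochain.mk_eq_mk (add_assoc _ _ _) fun g => by
    simp [Cochain.ev_mul, mul_assoc, add_assoc]
  mul_zero a := by ext; simp [GradedMonoid.GMul.mul, Cochain.cup]
  zero_mul a := by ext; simp [GradedMonoid.GMul.mul, Cochain.cup]
  mul_add a b c := by ext; simp [GradedMonoid.GMul.mul, Cochain.cup, mul_add]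
  add_mul a b c := by ext; simp [GradedMonoid.GMul.mul, Cochain.cup, add_mul]
  natCast n := ContinuousMap.const _ (n : ZMod p)
  natCast_zero := by ext; simp
  natCast_succ n := by ext; simp [GradedMonoid.GOne.one]
  intCast n := ContinuousMap.const _ (n : ZMod p)
  intCast_ofNat n := by ext; simp
  intCast_negSucc_ofNat n := by ext; simp

instance : DirectSum.GAlgebra (ZMod p) (Cochain p G) where
  toFun :=
    { toFun := fun c => ContinuousMap.const _ c
      map_zero' := rfl
      map_add' := fun _ _ => rfl }
  map_one := rfl
  map_mul r s := Cochain.mk_eq_mk rfl fun g => rfl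
  commutes r x := Cochain.mk_eq_mk (by simp [GradedMonoid.mk]) fun g => by
    change r * Cochain.ev x.2 (fun i => g (0 + i)) = Cochain.ev x.2 g * r
    simp [mul_comm]
  smul_def r x := Cochain.mk_eq_mk (by simp [GradedMonoid.mk]) fun g => by
    change r * Cochain.ev x.2 g = r * Cochain.ev x.2 (fun i => g (0 + i))
    simp

/-- The differential of inhomogeneous cochains:
`(δφ)(g_1, …, g_{n+1}) = φ(g_2, …, g_{n+1}) + ∑_{1 ≤ i ≤ n} (-1)^i φ(g_1, …, g_i g_{i+1}, …, g_{n+1})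
  + (-1)^{n+1} φ(g_1, …, g_n)`. -/
def Cochain.δ [IsTopologicalGroup G] (n : ℕ) : Cochain p G n →ₗ[ZMod p] Cochain p G (n + 1) where
  toFun φ :=
    { toFun := fun g => φ (fun i => g i.succ) +
        ∑ i : Fin n, (-1) ^ ((i : ℕ) + 1) * φ (i.castSucc.contractNth (· * ·) g) +
        (-1) ^ (n + 1) * φ (fun i => g i.castSucc)
      continuous_toFun := by
        have h (i : Fin n) : Continuous fun g : Fin (n + 1) → G =>
            i.castSucc.contractNth (· * ·) g := by
          refine continuous_pi fun j => ?_
          unfold Fin.contractNth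
          split_ifs <;> fun_prop
        fun_prop }
  map_add' φ ψ := by
    ext g
    simp [mul_add, Finset.sum_add_distrib]
    ring
  map_smul' c φ := by
    ext g
    simp [Finset.mul_sum, mul_add, mul_left_comm]

/-- The `i`-th face of a sequence: omit the first term (`i = 0`), or multiply the terms number `i`
and `i + 1`, counted from `1` on (`i > 0`). -/
def Cochain.face (i : ℕ) (g : ℕ → G) (j : ℕ) : G :=
  if j + 1 < i then g j else if j + 1 = i then g j * g (j + 1) else g (j + 1)

theorem Cochain.ev_δ [IsTopologicalGroup G] {n : ℕ} (φ : Cochain p G n) (g : ℕ → G) :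
    (Cochain.δ n φ).ev g = ∑ i ∈ range (n + 2), (-1) ^ i * φ.ev (face i g) := by
  rw [Finset.sum_range_succ, Finset.sum_range_succ']
  have h0 : φ.ev (face 0 g) = φ fun i : Fin n => g (i + 1) := by
    simp [Cochain.ev, face]
  have hn : φ.ev (face (n + 1) g) = φ fun i : Fin n => g i := by
    unfold Cochain.ev face
    congr 1
    funext i
    simp
  have hi (i : Fin n) : φ.ev (face (i + 1) g) =
      φ (i.castSucc.contractNth (· * ·) fun j => g j) := by
    unfold Cochain.ev face Fin.contractNth
    congr 1
    funext j
    simp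
  rw [h0, hn, ← Fin.sum_univ_eq_sum_range (fun i => (-1) ^ (i + 1) * φ.ev (face (i + 1) g)) n]
  simp only [hi]
  simp [Cochain.ev, Cochain.δ]
  ring

theorem Cochain.face_face {i j : ℕ} (h : j < i) (g : ℕ → G) :
    face j (face i g) = face (i - 1) (face j g) := by
  funext l
  obtain ⟨i, rfl⟩ : ∃ i', i = i' + 1 := ⟨i - 1, by omega⟩
  simp only [face, Nat.add_sub_cancel]
  split_ifs <;> first | omega | rfl | simp [mul_assoc]

theorem Cochain.δ_δ [IsTopologicalGroup G] {n : ℕ} (φ : Cochain p G n) :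
    Cochain.δ (n + 1) (Cochain.δ n φ) = 0 := by
  refine Cochain.ext_ev fun g => ?_
  rw [show Cochain.ev (0 : Cochain p G (n + 1 + 1)) g = 0 from rfl]
  simp only [Cochain.ev_δ, Finset.mul_sum, ← Finset.sum_product']
  rw [← Finset.sum_filter_add_sum_filter_not _ (fun q : ℕ × ℕ => q.2 < q.1), add_eq_zero_iff_eq_neg,
    ← Finset.sum_neg_distrib]
  refine Finset.sum_nbij' (fun q => (q.2, q.1 - 1)) (fun q => (q.2 + 1, q.1)) ?_ ?_ ?_ ?_ ?_
  · intro q hq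
    simp only [Finset.mem_filter, Finset.mem_product, Finset.mem_range] at hq ⊢
    omega
  · intro q hq
    simp only [Finset.mem_filter, Finset.mem_product, Finset.mem_range] at hq ⊢
    omega
  · intro q hq
    simp only [Finset.mem_filter, Finset.mem_product, Finset.mem_range] at hq
    ext <;> simp; omega
  · intro q hq
    simp
  · intro q hq
    simp only [Finset.mem_filter, Finset.mem_product, Finset.mem_range] at hq
    obtain ⟨i, j⟩ := q
    obtain ⟨i, rfl⟩ : ∃ i', i = i' + 1 := ⟨i - 1, by simp at hq; omega⟩
    simp only at hq ⊢
    rw [Cochain.face_face hq.2]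
    simp only [Nat.add_sub_cancel]
    ring

theorem Cochain.δ_cup [IsTopologicalGroup G] {m n : ℕ} (φ : Cochain p G m) (ψ : Cochain p G n)
    (g : ℕ → G) :
    (Cochain.δ (m + n) (φ.cup ψ)).ev g =
      (Cochain.δ m φ).ev g * ψ.ev (fun i => g (m + 1 + i)) +
        (-1) ^ m * (φ.ev g * (Cochain.δ n ψ).ev fun i => g (m + i)) := by
  have h1 (i : ℕ) (hi : i ≤ m) : (φ.cup ψ).ev (face i g) =
      φ.ev (face i g) * ψ.ev (fun j => g (m + 1 + j)) := by
    rw [Cochain.ev_cup]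
    congr 2
    funext j
    simp only [face]
    split_ifs <;> first | omega | (congr 1; omega)
  have h2 (i : ℕ) : (φ.cup ψ).ev (face (m + (i + 1)) g) =
      φ.ev g * ψ.ev (face (i + 1) fun j => g (m + j)) := by
    rw [Cochain.ev_cup]
    congr 1
    · unfold Cochain.ev face
      congr 1
      funext j
      have := j.2
      split_ifs <;> first | omega | rfl
    · congr 1
      funext j
      simp only [face]
      split_ifs <;> first | omega | rfl
  have h3 : φ.ev (face (m + 1) g) = φ.ev g := by
    unfold Cochain.ev face
    congr 1
    funext j
    simp
  have h4 : face 0 (fun j => g (m + j)) = fun j => g (m + 1 + j) := by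
    funext j
    exact congrArg g (by omega)
  rw [Cochain.ev_δ, Cochain.ev_δ, Cochain.ev_δ, show m + n + 2 = (m + 1) + (n + 1) by omega,
    Finset.sum_range_add, Finset.sum_range_succ _ (m + 1), Finset.sum_range_succ' _ (n + 1), h3, h4]
  have e1 : ∑ i ∈ range (m + 1), (-1) ^ i * (φ.cup ψ).ev (face i g) =
      (∑ i ∈ range (m + 1), (-1) ^ i * φ.ev (face i g)) * ψ.ev (fun j => g (m + 1 + j)) := by
    rw [Finset.sum_mul]
    refine Finset.sum_congr rfl fun i hi => ?_
    rw [h1 i (by rw [Finset.mem_range] at hi; omega), mul_assoc]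
  have e2 : ∑ i ∈ range (n + 1), (-1) ^ (m + 1 + i) * (φ.cup ψ).ev (face (m + 1 + i) g) =
      (-1) ^ m * (φ.ev g * ∑ i ∈ range (n + 1), (-1) ^ (i + 1) *
        ψ.ev (face (i + 1) fun j => g (m + j))) := by
    rw [Finset.mul_sum, Finset.mul_sum]
    refine Finset.sum_congr rfl fun i hi => ?_
    rw [show m + 1 + i = m + (i + 1) by omega, h2]
    ring
  rw [e1, e2]
  ring

variable (p G) in
/-- The elements of `⨁ n, C^n(G, 𝔽_p)` that are concentrated in degree `i`; there are no nonzero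
such elements if `i < 0`. -/
def cochainGrading (i : ℤ) : Submodule (ZMod p) (⨁ n, Cochain p G n) where
  carrier := {x | ∀ n : ℕ, (n : ℤ) ≠ i → x n = 0}
  add_mem' hx hy n hn := by rw [DirectSum.add_apply, hx n hn, hy n hn, add_zero]
  zero_mem' n _ := rfl
  smul_mem' c x hx n hn := by rw [DirectSum.smul_apply, hx n hn, smul_zero]

theorem of_mem_cochainGrading {n : ℕ} (φ : Cochain p G n) :
    DirectSum.of (Cochain p G) n φ ∈ cochainGrading p G n := by
  intro m hm
  exact DirectSum.of_eq_of_ne _ _ _ (by exact_mod_cast hm)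

theorem mem_cochainGrading_iff {i : ℤ} {x : ⨁ n, Cochain p G n} :
    x ∈ cochainGrading p G i ↔
      x = 0 ∨ ∃ (n : ℕ) (φ : Cochain p G n), (n : ℤ) = i ∧ x = DirectSum.of (Cochain p G) n φ := by
  constructor
  · intro hx
    by_cases hi : 0 ≤ i
    · lift i to ℕ using hi
      refine Or.inr ⟨i, x i, rfl, ?_⟩
      refine DFinsupp.ext fun n => ?_
      by_cases hn : n = i
      · subst hn; exact (DirectSum.of_eq_same _ _).symm
      · exact (hx n (by exact_mod_cast hn)).trans (DirectSum.of_eq_of_ne _ _ _ hn).symm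
    · refine Or.inl (DFinsupp.ext fun n => hx n (by omega))
  · rintro (rfl | ⟨n, φ, rfl, rfl⟩)
    · exact zero_mem _
    · exact of_mem_cochainGrading φ

theorem cochainGrading_isInternal : DirectSum.IsInternal (cochainGrading p G) := by
  rw [DirectSum.isInternal_submodule_iff_iSupIndep_and_iSup_eq_top]
  constructor
  · intro i
    rw [Submodule.disjoint_def]
    intro x hx hx'
    refine DFinsupp.ext fun n => ?_
    by_cases hn : (n : ℤ) = i
    · have hle : (⨆ j, ⨆ (_ : j ≠ i), cochainGrading p G j) ≤
          LinearMap.ker (DirectSum.component (ZMod p) ℕ (Cochain p G) n) :=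
        iSup_le fun j => iSup_le fun hj y hy => hy n (by omega)
      exact hle hx'
    · exact hx n hn
  · rw [eq_top_iff]
    rintro x -
    induction x using DirectSum.induction_on with
    | zero => exact zero_mem _
    | of n φ => exact Submodule.mem_iSup_of_mem (n : ℤ) (of_mem_cochainGrading φ)
    | add x y hx hy => exact add_mem hx hy

instance : SetLike.GradedMonoid (cochainGrading p G) where
  one_mem := of_mem_cochainGrading (n := 0) GradedMonoid.GOne.one
  mul_mem := by
    intro i j x y hx hy
    rcases mem_cochainGrading_iff.1 hx with rfl | ⟨m, φ, rfl, rfl⟩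
    · rw [zero_mul]; exact zero_mem _
    rcases mem_cochainGrading_iff.1 hy with rfl | ⟨n, ψ, rfl, rfl⟩
    · rw [mul_zero]; exact zero_mem _
    rw [DirectSum.of_mul_of]
    rw [← Nat.cast_add]
    exact of_mem_cochainGrading (φ.cup ψ)

variable (p G) [IsTopologicalGroup G]

/-- The total differential on `⨁ n, C^n(G, 𝔽_p)`. -/
def cochainD : (⨁ n, Cochain p G n) →ₗ[ZMod p] ⨁ n, Cochain p G n :=
  DirectSum.toModule (ZMod p) ℕ _ fun n => DirectSum.lof (ZMod p) ℕ (Cochain p G) (n + 1) ∘ₗ Cochain.δ n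

variable {p G}

theorem cochainD_of {n : ℕ} (φ : Cochain p G n) :
    cochainD p G (DirectSum.of (Cochain p G) n φ) =
      DirectSum.of (Cochain p G) (n + 1) (Cochain.δ n φ) := by
  exact DirectSum.toModule_lof (ZMod p) n φ

theorem cochainD_mem {i : ℤ} {x : ⨁ n, Cochain p G n} (hx : x ∈ cochainGrading p G i) :
    cochainD p G x ∈ cochainGrading p G (i + 1) := by
  rcases mem_cochainGrading_iff.1 hx with rfl | ⟨m, φ, rfl, rfl⟩
  · rw [map_zero]; exact zero_mem _
  · rw [cochainD_of]
    exact_mod_cast of_mem_cochainGrading (Cochain.δ m φ)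

theorem cochainD_cochainD (x : ⨁ n, Cochain p G n) : cochainD p G (cochainD p G x) = 0 := by
  induction x using DirectSum.induction_on with
  | zero => simp
  | of n φ => rw [cochainD_of, cochainD_of, Cochain.δ_δ, map_zero]
  | add x y hx hy => rw [map_add, map_add, hx, hy, add_zero]

theorem cochainD_mul {i : ℤ} {x : ⨁ n, Cochain p G n} (hx : x ∈ cochainGrading p G i)
    (y : ⨁ n, Cochain p G n) :
    cochainD p G (x * y) = cochainD p G x * y + i.negOnePow • (x * cochainD p G y) := by
  rcases mem_cochainGrading_iff.1 hx with rfl | ⟨m, φ, rfl, rfl⟩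
  · simp
  induction y using DirectSum.induction_on with
  | zero => simp
  | of n ψ =>
    have h : (GradedMonoid.mk (m + 1 + n) ((Cochain.δ m φ).cup ψ) : GradedMonoid (Cochain p G)) =
        GradedMonoid.mk (m + n + 1)
          (Cochain.δ (m + n) (φ.cup ψ) - (-1 : ZMod p) ^ m • φ.cup (Cochain.δ n ψ)) := by
      refine Cochain.mk_eq_mk (by omega) fun g => ?_
      have h1 : Cochain.ev (Cochain.δ (m + n) (φ.cup ψ) - (-1 : ZMod p) ^ m • φ.cup (Cochain.δ n ψ)) g
          = (Cochain.δ (m + n) (φ.cup ψ)).ev g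
            - (-1) ^ m * (φ.ev g * (Cochain.δ n ψ).ev fun i => g (m + i)) := rfl
      rw [h1, Cochain.δ_cup, Cochain.ev_cup]
      ring
    have h2 := DirectSum.of_eq_of_gradedMonoid_eq h
    rw [map_sub] at h2
    have h3 : DirectSum.of (Cochain p G) (m + n + 1) ((-1 : ZMod p) ^ m • φ.cup (Cochain.δ n ψ)) =
        (m : ℤ).negOnePow • DirectSum.of (Cochain p G) (m + n + 1) (φ.cup (Cochain.δ n ψ)) := by
      rcases Nat.even_or_odd m with hm | hm
      · rw [hm.neg_one_pow, Int.negOnePow_even _ (by exact_mod_cast hm), one_smul, one_smul]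
      · rw [hm.neg_one_pow, Int.negOnePow_odd _ (by exact_mod_cast hm), neg_smul, one_smul, map_neg,
          Units.neg_smul, one_smul]
    rw [h3] at h2
    rw [cochainD_of, cochainD_of, DirectSum.of_mul_of, DirectSum.of_mul_of, DirectSum.of_mul_of,
      cochainD_of]
    exact (sub_eq_iff_eq_add.1 h2.symm)
  | add y z hy hz =>
    rw [mul_add, map_add, hy, hz, map_add, mul_add, mul_add, smul_add]
    abel

variable (p G) in
/-- The differential graded `𝔽_p`-algebra `C^•(G, 𝔽_p)` of continuous inhomogeneous cochains of `G`,
with the cup product as multiplication. -/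
def cochainAlgebra [Fact p.Prime] : DGAlg.{0, u} (ZMod p) where
  carrier := ⨁ n, Cochain p G n
  grading := cochainGrading p G
  isInternal := cochainGrading_isInternal
  d := cochainD p G
  d_mem := cochainD_mem
  d_d := cochainD_cochainD
  leibniz := cochainD_mul

end GroupCohomology

section ProP

open Filter Topology

/-- A topological group is a pro-`p` group if it is profinite (that is, compact, Hausdorff and totally
disconnected) and every open normal subgroup has index a power of `p`. -/
structure IsProP (p : ℕ) (G : Type u) [Group G] [TopologicalSpace G] [IsTopologicalGroup G] :
    Prop where
  compactSpace : CompactSpace G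
  t2Space : T2Space G
  totallyDisconnectedSpace : TotallyDisconnectedSpace G
  index_eq_pow : ∀ U : OpenNormalSubgroup G, ∃ n : ℕ, U.toSubgroup.index = p ^ n

/-- `G` is a free pro-`p` group on the family `ι : X → G`: it is a pro-`p` group, the family `ι`
converges to `1` (every neighbourhood of `1` contains all but finitely many of its members), and
`G` is universal with these properties. -/
structure IsFreeProP (p : ℕ) {G : Type u} [Group G] [TopologicalSpace G] [IsTopologicalGroup G]
    {X : Type v} (ι : X → G) : Prop where
  isProP : IsProP p G
  tendsto : Tendsto ι cofinite (𝓝 1)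
  existsUnique_lift : ∀ (H : Type u) [Group H] [TopologicalSpace H] [IsTopologicalGroup H],
    IsProP p H → ∀ f : X → H, Tendsto f cofinite (𝓝 1) → ∃! φ : G →ₜ* H, ∀ x, φ (ι x) = f x

end ProP

/-! Only three features of the cohomology algebra `H` matter (`GradedAlg.IsFreeType`): it is
nonzero, degree 0 consists of the scalars, and all degrees other than 0 and 1 vanish. They are
invariant under isomorphism, so both claims follow from one formality statement for dg algebras with
such cohomology, once a free pro-`p` group is known to have no cohomology in degrees at least 2.

Vanishing (`IsFreeProP.exists_δ_eq`): singling out the first argument turns a cocycle of degree `n +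
2` into a crossed homomorphism with values in cochains of degree `n + 1`, for a twisted translation
action. Crossed homomorphisms into a finite module over `𝔽_p`, with action through a finite
quotient, are homomorphisms into a finite `p`-group. Freeness therefore prescribes them arbitrarily
on the basis, up to convergence (`crossed_exists`, `crossed_unique`). So the given one lifts to the
untwisted translation module, which is coinduced; there the lift is principal, and this exhibits the
cocycle as a coboundary.

Formality (`formalityMap_relation`): choose linear representatives `s` of the classes of degree 1
and linear primitives `h` of the cocycles of degree 2. Because `H^2 = 0`, the recursion `T_n = h (∑
T_i T_j)` meets no obstruction; it is a universal defining system for Massey products (`d_massey`).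
With the augmentation `ε`, the maps `f_1 = ε + s` and `f_n = ± T_n s^{⊗ n}` form an `A_∞`-morphism
from `H` with zero differential: the only nonzero products in `H` have a scalar factor, and their
contributions telescope. -/

/-! ### Crossed homomorphisms on a free pro-`p` group -/

section CrossedHom

set_option linter.unusedSectionVars false

open Filter Topology MulOpposite

/-- The semidirect product of a group `Q` with an abelian group `V` on which `Q` acts from the
right: `(v, q) (v', q') = (v q' + v', q q')`. -/
@[ext]
structure RightSemidirect {Q : Type u} {V : Type v} [Group Q] [AddCommGroup V]
    (ρ : Q →* (AddMonoid.End V)ᵐᵒᵖ) where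
  vec : V
  grp : Q

namespace RightSemidirect

variable {Q : Type u} {V : Type v} [Group Q] [AddCommGroup V] (ρ : Q →* (AddMonoid.End V)ᵐᵒᵖ)

instance : Mul (RightSemidirect ρ) := ⟨fun a b => ⟨unop (ρ b.grp) a.vec + b.vec, a.grp * b.grp⟩⟩

instance : One (RightSemidirect ρ) := ⟨⟨0, 1⟩⟩

instance : Inv (RightSemidirect ρ) := ⟨fun a => ⟨-unop (ρ a.grp⁻¹) a.vec, a.grp⁻¹⟩⟩

theorem mul_vec (a b : RightSemidirect ρ) : (a * b).vec = unop (ρ b.grp) a.vec + b.vec := rfl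

theorem mul_grp (a b : RightSemidirect ρ) : (a * b).grp = a.grp * b.grp := rfl

instance : Group (RightSemidirect ρ) :=
  Group.ofLeftAxioms
    (fun a b c => by
      ext
      · simp [mul_vec, mul_grp, add_assoc]
      · simp [mul_grp, mul_assoc])
    (fun a => by
      ext
      · change unop (ρ a.grp) 0 + a.vec = a.vec
        simp
      · exact one_mul a.grp)
    (fun a => by
      ext
      · change unop (ρ a.grp) (-unop (ρ a.grp⁻¹) a.vec) + a.vec = 0
        have h : unop (ρ a.grp) (unop (ρ a.grp⁻¹) a.vec) = unop (ρ (a.grp⁻¹ * a.grp)) a.vec := by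
          rw [map_mul]; rfl
        rw [map_neg, h]
        simp
      · exact inv_mul_cancel a.grp)

/-- The projection onto the acting group. -/
def toGrp : RightSemidirect ρ →* Q where
  toFun := grp
  map_one' := rfl
  map_mul' _ _ := rfl

/-- The underlying pair. -/
def equivProd : RightSemidirect ρ ≃ V × Q where
  toFun a := (a.vec, a.grp)
  invFun a := ⟨a.1, a.2⟩
  left_inv _ := rfl
  right_inv _ := rfl

instance : TopologicalSpace (RightSemidirect ρ) := ⊥

instance : DiscreteTopology (RightSemidirect ρ) := ⟨rfl⟩

end RightSemidirect

theorem isProP_of_card {p : ℕ} (hp : p.Prime) {W : Type u} [Group W] [TopologicalSpace W]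
    [DiscreteTopology W] [IsTopologicalGroup W] {n : ℕ} (h : Nat.card W = p ^ n) : IsProP p W where
  compactSpace := by
    have : Finite W := Nat.finite_of_card_ne_zero (by rw [h]; exact pow_ne_zero _ hp.ne_zero)
    infer_instance
  t2Space := inferInstance
  totallyDisconnectedSpace := inferInstance
  index_eq_pow U := by
    obtain ⟨k, -, hk⟩ := (Nat.dvd_prime_pow hp).1 (h ▸ U.toSubgroup.index_dvd_card)
    exact ⟨k, hk⟩

variable {p : ℕ} [hp : Fact p.Prime] {G : Type u} [Group G] [TopologicalSpace G]
  [IsTopologicalGroup G] {X : Type v} {ι : X → G}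

namespace IsFreeProP

variable {V : Type u} [AddCommGroup V] [Module (ZMod p) V] [Finite V]
  (ρ : G →* (AddMonoid.End V)ᵐᵒᵖ) (U : OpenNormalSubgroup G)

theorem card_quotient_eq_pow (hG : IsFreeProP p ι) : ∃ n, Nat.card (G ⧸ U.toSubgroup) = p ^ n :=
  hG.isProP.index_eq_pow U

/-- Both factors have `p`-power order, so this is a finite `p`-group. Letting `G ⧸ U` act instead of
`G` is what makes it finite. -/
theorem isProP_rightSemidirect (hG : IsFreeProP p ι) (hU : U.toSubgroup ≤ ρ.ker) :
    IsProP p (RightSemidirect (QuotientGroup.lift U.toSubgroup ρ hU)) := by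
  obtain ⟨n, hn⟩ := hG.card_quotient_eq_pow U
  refine isProP_of_card hp.out (n := Module.finrank (ZMod p) V + n) ?_
  rw [Nat.card_congr (RightSemidirect.equivProd _), Nat.card_prod, hn,
    Module.natCard_eq_pow_finrank (K := ZMod p), Nat.card_zmod, pow_add]

/-- A crossed homomorphism to a finite module, as a homomorphism to the semidirect product. -/
theorem exists_hom_of_crossed (hU : U.toSubgroup ≤ ρ.ker) {D : G → V} (hD : IsLocallyConstant D)
    (hmul : ∀ g h, D (g * h) = unop (ρ h) (D g) + D h) :
    ∃ φ : G →ₜ* RightSemidirect (QuotientGroup.lift U.toSubgroup ρ hU),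
      ∀ g, φ g = ⟨D g, (g : G ⧸ U.toSubgroup)⟩ := by
  have h1 : D 1 = 0 := by simpa using hmul 1 1
  refine ⟨{ toFun := fun g => ⟨D g, (g : G ⧸ U.toSubgroup)⟩
            map_one' := ?_
            map_mul' := ?_
            continuous_toFun := ?_ }, fun g => rfl⟩
  · ext
    · exact h1
    · rfl
  · intro g h
    ext
    · exact hmul g h
    · rfl
  · have hq : IsLocallyConstant (fun g : G => (g : G ⧸ U.toSubgroup)) := by
      have : DiscreteTopology (G ⧸ U.toSubgroup) :=
        QuotientGroup.discreteTopology U.toOpenSubgroup.isOpen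
      exact (IsLocallyConstant.iff_continuous _).2 continuous_quotient_mk'
    exact ((hD.prodMk hq).comp fun q : V × (G ⧸ U.toSubgroup) =>
      (⟨q.1, q.2⟩ : RightSemidirect (QuotientGroup.lift U.toSubgroup ρ hU))).continuous

/-- The homomorphisms `g ↦ (D g, gU)` and `g ↦ (D' g, gU)` agree on the basis, so the universal
property identifies them. -/
theorem crossed_unique (hG : IsFreeProP p ι) (hU : U.toSubgroup ≤ ρ.ker)
    {D D' : G → V} (hD : IsLocallyConstant D) (hD' : IsLocallyConstant D')
    (hmul : ∀ g h, D (g * h) = unop (ρ h) (D g) + D h)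
    (hmul' : ∀ g h, D' (g * h) = unop (ρ h) (D' g) + D' h)
    (heq : ∀ x, D (ι x) = D' (ι x)) : D = D' := by
  obtain ⟨φ, hφ⟩ := exists_hom_of_crossed ρ U hU hD hmul
  obtain ⟨φ', hφ'⟩ := exists_hom_of_crossed ρ U hU hD' hmul'
  have ht : Tendsto (fun x => φ (ι x)) cofinite (𝓝 1) := by
    rw [← map_one φ]
    exact (φ.continuous_toFun.tendsto 1).comp hG.tendsto
  have h := (hG.existsUnique_lift _ (hG.isProP_rightSemidirect ρ U hU) _ ht).unique
    (y₁ := φ) (y₂ := φ') (fun x => rfl) fun x => by rw [hφ, hφ', heq]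
  funext g
  have := congrArg RightSemidirect.vec (congrArg (fun ψ => ψ g) h)
  simpa [hφ, hφ'] using this

/-- The first component of the homomorphism that sends the basis to `(v x, ι x U)`. Finite support
of `v` makes this family converge to `1`. -/
theorem crossed_exists (hG : IsFreeProP p ι) (hU : U.toSubgroup ≤ ρ.ker)
    (v : X → V) (hv : ∀ᶠ x in cofinite, v x = 0) :
    ∃ D : G → V, IsLocallyConstant D ∧ (∀ g h, D (g * h) = unop (ρ h) (D g) + D h) ∧
      ∀ x, D (ι x) = v x := by
  have hQ : DiscreteTopology (G ⧸ U.toSubgroup) :=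
    QuotientGroup.discreteTopology U.toOpenSubgroup.isOpen
  obtain ⟨n, hn⟩ := hG.card_quotient_eq_pow U
  have hx : ∀ᶠ x in cofinite, ι x ∈ U.toSubgroup :=
    hG.tendsto (U.toOpenSubgroup.isOpen.mem_nhds U.toSubgroup.one_mem)
  obtain ⟨φ, hφ, -⟩ := hG.existsUnique_lift _ (hG.isProP_rightSemidirect ρ U hU)
    (fun x => ⟨v x, (ι x : G ⧸ U.toSubgroup)⟩) (tendsto_nhds_of_eventually_eq (by
      filter_upwards [hv, hx] with x h1 h2
      ext
      · exact h1
      · exact (QuotientGroup.eq_one_iff _).2 h2))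
  -- The second component of `φ` and the quotient map agree on the basis, so uniqueness of lifts to
  -- `G ⧸ U` identifies them.
  have hgrp : ∀ g, (φ g).grp = (g : G ⧸ U.toSubgroup) := by
    let q : G →ₜ* G ⧸ U.toSubgroup :=
      { QuotientGroup.mk' U.toSubgroup with continuous_toFun := continuous_quotient_mk' }
    let q' : G →ₜ* G ⧸ U.toSubgroup :=
      { (RightSemidirect.toGrp _).comp φ.toMonoidHom with
        continuous_toFun := (continuous_of_discreteTopology (f := RightSemidirect.grp)).comp
          φ.continuous_toFun }
    have ht : Tendsto (fun x => q (ι x)) cofinite (𝓝 1) := by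
      rw [← map_one q]
      exact (q.continuous_toFun.tendsto 1).comp hG.tendsto
    have h := (hG.existsUnique_lift _ (isProP_of_card hp.out hn) _ ht).unique
      (y₁ := q') (y₂ := q) (fun x => congrArg RightSemidirect.grp (hφ x)) fun x => rfl
    exact fun g => congrArg (fun ψ => ψ g) h
  refine ⟨fun g => (φ g).vec, ?_, ?_, fun x => congrArg RightSemidirect.vec (hφ x)⟩
  · exact ((IsLocallyConstant.iff_continuous _).2 φ.continuous_toFun).comp _
  · intro g h
    dsimp only
    rw [map_mul, RightSemidirect.mul_vec, hgrp]
    rfl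

end IsFreeProP

end CrossedHom

/-! ### Cocycles as crossed homomorphisms, and vanishing in degrees at least 2 -/

section CocyclesOfFree

set_option linter.unusedSectionVars false

open Filter Topology MulOpposite Finset

variable {p : ℕ} {G : Type u} [Group G] [TopologicalSpace G]

namespace Cochain

/-- The sequence `g, h_0, h_1, …`. -/
def seqCons (g : G) (h : ℕ → G) : ℕ → G
  | 0 => g
  | j + 1 => h j

theorem seqCons_restrict (n : ℕ) (g : G) (h : ℕ → G) :
    (fun i : Fin (n + 1) => seqCons g h i) = Fin.cons g fun i : Fin n => h i := by
  funext i
  refine Fin.cases ?_ (fun i => ?_) i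
  · rfl
  · simp [seqCons]

/-- Insert a fixed group element as the first argument. -/
def insertFirst {n : ℕ} (g : G) : Cochain p G (n + 1) →ₗ[ZMod p] Cochain p G n where
  toFun f := ⟨fun h => f (Fin.cons g h), by fun_prop⟩
  map_add' _ _ := rfl
  map_smul' _ _ := rfl

/-- Ignore the first argument. -/
def ignoreFirst {n : ℕ} : Cochain p G n →ₗ[ZMod p] Cochain p G (n + 1) where
  toFun f := ⟨fun h => f fun i => h i.succ, by fun_prop⟩
  map_add' _ _ := rfl
  map_smul' _ _ := rfl

theorem ev_insertFirst {n : ℕ} (g : G) (f : Cochain p G (n + 1)) (h : ℕ → G) :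
    (insertFirst g f).ev h = f.ev (seqCons g h) := by
  unfold ev
  rw [seqCons_restrict]
  rfl

theorem ev_ignoreFirst {n : ℕ} (f : Cochain p G n) (h : ℕ → G) :
    (ignoreFirst f).ev h = f.ev fun j => h (j + 1) := by
  simp [ev, ignoreFirst]

theorem ext_insertFirst {n : ℕ} {f f' : Cochain p G (n + 1)}
    (h : ∀ g, insertFirst g f = insertFirst g f') : f = f' := by
  ext x
  have := congrArg (fun F : Cochain p G n => F (Fin.tail x)) (h (x 0))
  simpa [insertFirst] using this

theorem insertFirst_ignoreFirst {n : ℕ} (g : G) (f : Cochain p G n) :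
    insertFirst g (ignoreFirst f) = f := rfl

variable [IsTopologicalGroup G]

/-- The right action of `G` on cochains by translation of the first argument. -/
def translate {n : ℕ} (g : G) : Cochain p G (n + 1) →ₗ[ZMod p] Cochain p G (n + 1) where
  toFun f := ⟨fun h => f (Fin.cons (g * h 0) fun i => h i.succ), by fun_prop⟩
  map_add' _ _ := rfl
  map_smul' _ _ := rfl

theorem ev_translate {n : ℕ} (g : G) (f : Cochain p G (n + 1)) (h : ℕ → G) :
    (translate g f).ev h = f.ev (seqCons (g * h 0) fun j => h (j + 1)) := by
  unfold ev
  rw [seqCons_restrict]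
  simp [translate]

theorem translate_one {n : ℕ} (f : Cochain p G (n + 1)) : translate 1 f = f := by
  ext h
  change f (Fin.cons (1 * h 0) (Fin.tail h)) = f h
  rw [one_mul, Fin.cons_self_tail]

theorem translate_mul {n : ℕ} (g g' : G) (f : Cochain p G (n + 1)) :
    translate (g * g') f = translate g' (translate g f) := by
  ext h
  simp [translate, mul_assoc]

theorem insertFirst_translate {n : ℕ} (g g' : G) (f : Cochain p G (n + 1)) :
    insertFirst g' (translate g f) = insertFirst (g * g') f := by
  ext h
  simp [translate, insertFirst]

/-- Faces 0 and 1 of `(g, h_0, h_1, …)` give `f` and its translate. The later ones are the positive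
faces of `h`, with opposite sign; they add up to `-δ` except for face 0 of `h`, which the
`ignoreFirst` term compensates. -/
theorem insertFirst_δ' {n : ℕ} (g : G) (f : Cochain p G (n + 1)) :
    insertFirst g (δ (n + 1) f) =
      f - translate g f + ignoreFirst (insertFirst g f) - δ n (insertFirst g f) := by
  refine ext_ev fun h => ?_
  have e (a b c d : Cochain p G (n + 1)) : (a - b + c - d).ev h =
    a.ev h - b.ev h + c.ev h - d.ev h := rfl
  have h0 : face 0 (seqCons g h) = h := by
    funext j; simp [face, seqCons]
  have h1 : face 1 (seqCons g h) = seqCons (g * h 0) fun j => h (j + 1) := by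
    funext j; cases j <;> simp [face, seqCons]
  have h2 (i : ℕ) : face (i + 1 + 1) (seqCons g h) = seqCons g (face (i + 1) h) := by
    funext j; cases j <;> simp [face, seqCons]
  have h3 : face 0 h = fun j => h (j + 1) := by
    funext j; simp [face]
  rw [e, ev_insertFirst, ev_δ, ev_δ, ev_translate, ev_ignoreFirst]
  simp only [ev_insertFirst]
  rw [sum_range_succ', sum_range_succ', sum_range_succ' _ (n + 1)]
  simp only [zero_add, h0, h1, h2, h3, pow_succ, pow_zero, mul_neg, neg_mul, mul_one, neg_neg,
    sum_neg_distrib, one_mul]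
  ring

/-- The operator that turns translation into the action of `G` on cochains whose crossed
homomorphisms are the cocycles. -/
def twist {n : ℕ} : Cochain p G (n + 1) →ₗ[ZMod p] Cochain p G (n + 1) :=
  LinearMap.id - ignoreFirst ∘ₗ insertFirst 1 + δ n ∘ₗ insertFirst 1

theorem twist_apply {n : ℕ} (f : Cochain p G (n + 1)) :
    twist f = f - ignoreFirst (insertFirst 1 f) + δ n (insertFirst 1 f) := rfl

/-- Inserting `g` is translating by `g` and inserting `1`, so all terms of `insertFirst_δ'` but `f`
depend only on the translate. Coboundaries thus become principal crossed homomorphisms, up to sign.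
-/
theorem insertFirst_δ {n : ℕ} (g : G) (f : Cochain p G (n + 1)) :
    insertFirst g (δ (n + 1) f) = f - twist (translate g f) := by
  rw [insertFirst_δ', twist_apply, insertFirst_translate, mul_one]
  abel

/-- Insert `g` and then `g'` into `δ F = 0`. This is the rule of a crossed homomorphism, except that
`1` acts as `twist` and not as the identity. -/
theorem insertFirst_mul_of_δ_eq_zero {n : ℕ} {F : Cochain p G (n + 2)} (hF : δ (n + 2) F = 0)
    (g g' : G) :
    insertFirst (g * g') F = insertFirst g' F + twist (translate g' (insertFirst g F)) := by
  have h := congrArg (insertFirst g') (insertFirst_δ' g F)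
  rw [hF, map_zero, map_zero, map_sub, map_add, map_sub, insertFirst_translate,
    insertFirst_ignoreFirst, insertFirst_δ] at h
  rw [← sub_eq_zero, ← neg_eq_zero, h]
  abel

/-- The preceding rule, applied to the cocycle `δ f`. It makes `twist` a projection and `twist ∘
translate` a right action on its image. -/
theorem twist_translate_twist {n : ℕ} (g g' : G) (f : Cochain p G (n + 1)) :
    twist (translate g' (twist (translate g f))) = twist (translate (g * g') f) := by
  have h := insertFirst_mul_of_δ_eq_zero (δ_δ f) g g'
  simp only [insertFirst_δ, map_sub, translate_mul] at h
  rw [translate_mul, ← sub_eq_zero, ← sub_eq_zero.2 h]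
  abel

theorem twist_translate_twist' {n : ℕ} (g : G) (f : Cochain p G (n + 1)) :
    twist (translate g (twist f)) = twist (translate g f) := by
  simpa [translate_one] using twist_translate_twist 1 g f

theorem twist_twist {n : ℕ} (f : Cochain p G (n + 1)) : twist (twist f) = twist f := by
  simpa [translate_one] using twist_translate_twist 1 1 f

/-! ### Cochains inflated from the quotient by an open normal subgroup -/

section Inflated

variable (U : OpenNormalSubgroup G)

variable (p) in
/-- The cochains that are inflated from `G ⧸ U`. -/
def inflated (n : ℕ) : Submodule (ZMod p) (Cochain p G n) where
  carrier := {f | ∀ g h : Fin n → G, (∀ i, (g i : G ⧸ U.toSubgroup) = h i) → f g = f h}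
  add_mem' ha hb g h H := congrArg₂ (· + ·) (ha g h H) (hb g h H)
  zero_mem' _ _ _ := rfl
  smul_mem' c _ ha g h H := congrArg (c • ·) (ha g h H)

variable {U}

theorem inflated_ev {n : ℕ} {f : Cochain p G n} (hf : f ∈ inflated p U n) {g h : ℕ → G}
    (H : ∀ i, (g i : G ⧸ U.toSubgroup) = h i) : f.ev g = f.ev h :=
  hf _ _ fun i => H i

theorem mem_inflated_of_ev {n : ℕ} {f : Cochain p G n}
    (hf : ∀ g h : ℕ → G, (∀ i, (g i : G ⧸ U.toSubgroup) = h i) → f.ev g = f.ev h) :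
    f ∈ inflated p U n := by
  intro g h H
  have := hf (fun i => if hi : i < n then g ⟨i, hi⟩ else 1)
    (fun i => if hi : i < n then h ⟨i, hi⟩ else 1) fun i => by
      by_cases hi : i < n
      · simpa [hi] using H ⟨i, hi⟩
      · simp [hi]
  simpa [ev] using this

theorem insertFirst_eq_of_mem_inflated {n : ℕ} {f : Cochain p G (n + 1)}
    (hf : f ∈ inflated p U (n + 1)) {g h : G} (H : (g : G ⧸ U.toSubgroup) = h) :
    insertFirst g f = insertFirst h f := by
  refine ext_ev fun x => ?_
  rw [ev_insertFirst, ev_insertFirst]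
  refine inflated_ev hf fun i => ?_
  cases i with
  | zero => exact H
  | succ i => rfl

theorem insertFirst_mem_inflated {n : ℕ} {f : Cochain p G (n + 1)}
    (hf : f ∈ inflated p U (n + 1)) (g : G) : insertFirst g f ∈ inflated p U n :=
  mem_inflated_of_ev fun x y H => by
    rw [ev_insertFirst, ev_insertFirst]
    refine inflated_ev hf fun i => ?_
    cases i with
    | zero => rfl
    | succ i => exact H i

theorem ignoreFirst_mem_inflated {n : ℕ} {f : Cochain p G n}
    (hf : f ∈ inflated p U n) : ignoreFirst f ∈ inflated p U (n + 1) :=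
  fun _ _ H => hf _ _ fun i => H i.succ

theorem translate_mem_inflated {n : ℕ} {f : Cochain p G (n + 1)}
    (hf : f ∈ inflated p U (n + 1)) (g : G) : translate g f ∈ inflated p U (n + 1) :=
  mem_inflated_of_ev fun x y H => by
    rw [ev_translate, ev_translate]
    refine inflated_ev hf fun i => ?_
    cases i with
    | zero =>
      simp only [seqCons, QuotientGroup.mk_mul, H]
    | succ i => exact H (i + 1)

theorem δ_mem_inflated {n : ℕ} {f : Cochain p G n} (hf : f ∈ inflated p U n) :
    δ n f ∈ inflated p U (n + 1) :=
  mem_inflated_of_ev fun x y H => by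
    rw [ev_δ, ev_δ]
    refine sum_congr rfl fun i _ => congrArg _ (inflated_ev hf fun j => ?_)
    unfold face
    split_ifs
    · exact H j
    · simp only [QuotientGroup.mk_mul, H]
    · exact H _

theorem twist_mem_inflated {n : ℕ} {f : Cochain p G (n + 1)} (hf : f ∈ inflated p U (n + 1)) :
    twist f ∈ inflated p U (n + 1) :=
  add_mem (sub_mem hf (ignoreFirst_mem_inflated (insertFirst_mem_inflated hf 1)))
    (δ_mem_inflated (insertFirst_mem_inflated hf 1))

theorem translate_eq_self_of_mem {n : ℕ} {f : Cochain p G (n + 1)}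
    (hf : f ∈ inflated p U (n + 1)) {g : G} (hg : g ∈ U.toSubgroup) : translate g f = f := by
  conv_rhs => rw [← translate_one f]
  refine ext_ev fun x => ?_
  rw [ev_translate, ev_translate]
  refine inflated_ev hf fun i => ?_
  cases i with
  | zero =>
    simp only [seqCons, QuotientGroup.mk_mul, (QuotientGroup.eq_one_iff g).2 hg,
      QuotientGroup.mk_one]
  | succ i => rfl

instance [CompactSpace G] [Fact p.Prime] (n : ℕ) : Finite (inflated p U n) := by
  have : Finite (G ⧸ U.toSubgroup) :=
    U.toSubgroup.quotient_finite_of_isOpen U.toOpenSubgroup.isOpen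
  refine Finite.of_injective
    (fun f : inflated p U n => fun q : Fin n → G ⧸ U.toSubgroup => f.1 fun i => (q i).out) ?_
  intro f f' h
  ext g
  have h := congrFun h fun i => (g i : G ⧸ U.toSubgroup)
  have e (F : inflated p U n) : F.1 (fun i => (g i : G ⧸ U.toSubgroup).out) = F.1 g :=
    F.2 _ _ fun i => QuotientGroup.out_eq' _
  simpa only [e] using h

/-- By compactness of `G^n`, a continuous function to a discrete space is uniformly locally
constant: one box around `1` serves all arguments, and an open normal subgroup fits into the
intersection of its sides. -/
theorem exists_mem_inflated [CompactSpace G] [TotallyDisconnectedSpace G] {n : ℕ}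
    (f : Cochain p G n) : ∃ U : OpenNormalSubgroup G, f ∈ inflated p U n := by
  have h : ∀ᶠ u in 𝓝 (1 : Fin n → G), ∀ g ∈ (Set.univ : Set (Fin n → G)), f (g * u) = f g := by
    refine isCompact_univ.eventually_forall_of_forall_eventually fun g _ => ?_
    have hc : Continuous fun q : (Fin n → G) × (Fin n → G) => (f (q.2 * q.1), f q.2) := by
      fun_prop
    exact hc.continuousAt.eventually
      ((isOpen_discrete {q : ZMod p × ZMod p | q.1 = q.2}).mem_nhds (by simp))
  rw [nhds_pi, Filter.Eventually, Filter.mem_pi'] at h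
  obtain ⟨I, t, ht, hI⟩ := h
  have hW : (⋂ i, t i) ∈ 𝓝 (1 : G) := Filter.iInter_mem.2 ht
  obtain ⟨W, hWt, hWo, hW1⟩ := mem_nhds_iff.1 hW
  obtain ⟨U, hU⟩ := ProfiniteGrp.exist_openNormalSubgroup_sub_open_nhds_of_one hWo hW1
  refine ⟨U, fun g h H => ?_⟩
  have hu : (g⁻¹ * h : Fin n → G) ∈ (I : Set (Fin n)).pi t := fun i _ =>
    Set.mem_iInter.1 (hWt (hU (QuotientGroup.eq.1 (H i)))) i
  have := hI hu g trivial
  rw [mul_inv_cancel_left] at this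
  exact this.symm

end Inflated

end Cochain

open Cochain in
/-- The cohomology of a free pro-`p` group with coefficients in `𝔽_p` vanishes in degrees `≥ 2`. -/
theorem IsFreeProP.exists_δ_eq [Fact p.Prime] [IsTopologicalGroup G] {X : Type v} {ι : X → G}
    (hG : IsFreeProP p ι) {n : ℕ} {F : Cochain p G (n + 2)} (hF : Cochain.δ (n + 2) F = 0) :
    ∃ f : Cochain p G (n + 1), Cochain.δ (n + 1) f = F := by
  have := hG.isProP.compactSpace
  have := hG.isProP.totallyDisconnectedSpace
  obtain ⟨U, hU⟩ := exists_mem_inflated F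
  -- `V`, with the translation action, is coinduced. `M` is its image under the projection `twist`,
  -- with the action `twist ∘ translate`, and `twist : V → M` is equivariant.
  let V := inflated p U (n + 1)
  let M : Submodule (ZMod p) (Cochain p G (n + 1)) :=
    V ⊓ LinearMap.ker (twist - LinearMap.id : Cochain p G (n + 1) →ₗ[ZMod p] _)
  have hM {f : Cochain p G (n + 1)} (hf : f ∈ V) (h : twist f = f) : f ∈ M :=
    ⟨hf, by simp [h]⟩
  have hM' {f : Cochain p G (n + 1)} (hf : f ∈ M) : twist f = f := by
    simpa [sub_eq_zero] using hf.2
  have : Finite M := Finite.of_injective (fun f : M => (⟨f.1, f.2.1⟩ : V)) fun f f' h =>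
    Subtype.ext (congrArg (fun q : V => q.1) h)
  let ρV : G →* (AddMonoid.End V)ᵐᵒᵖ :=
    { toFun := fun g => op
        { toFun := fun f => ⟨translate g f.1, translate_mem_inflated f.2 g⟩
          map_zero' := by ext1; exact map_zero _
          map_add' := fun f f' => by ext1; exact map_add _ _ _ }
      map_one' := by
        apply unop_injective
        ext f : 2
        exact translate_one _
      map_mul' := fun g h => by
        apply unop_injective
        ext f : 2
        exact translate_mul _ _ _ }
  let ρM : G →* (AddMonoid.End M)ᵐᵒᵖ :=
    { toFun := fun g => op
        { toFun := fun f => ⟨twist (translate g f.1),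
            hM (twist_mem_inflated (translate_mem_inflated f.2.1 g)) (twist_twist _)⟩
          map_zero' := by ext1; simp
          map_add' := fun f f' => by ext1; simp }
      map_one' := by
        apply unop_injective
        ext f : 2
        exact (congrArg twist (translate_one f.1)).trans (hM' f.2)
      map_mul' := fun g h => by
        apply unop_injective
        ext f : 2
        exact (twist_translate_twist g h f.1).symm }
  have hρV : U.toSubgroup ≤ ρV.ker := fun g hg => by
    apply unop_injective
    ext f : 2
    exact translate_eq_self_of_mem f.2 hg
  have hρM : U.toSubgroup ≤ ρM.ker := fun g hg => by
    apply unop_injective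
    ext f : 2
    exact (congrArg twist (translate_eq_self_of_mem f.2.1 hg)).trans (hM' f.2)
  have hK (g : G) : insertFirst g F - insertFirst 1 F = twist (insertFirst g F) := by
    have := insertFirst_mul_of_δ_eq_zero hF g 1
    rw [mul_one, translate_one] at this
    rw [sub_eq_iff_eq_add', ← this]
  have hDV (g : G) : twist (insertFirst g F) ∈ V :=
    twist_mem_inflated (insertFirst_mem_inflated hU g)
  -- By `hK`, this crossed homomorphism differs from `g ↦ insertFirst g F` only by the constant
  -- `insertFirst 1 F`.
  let D : G → M := fun g => ⟨twist (insertFirst g F), hM (hDV g) (twist_twist _)⟩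
  have hDmk {g h : G} (H : (g : G ⧸ U.toSubgroup) = h) :
      twist (insertFirst g F) = twist (insertFirst h F) := by
    rw [insertFirst_eq_of_mem_inflated hU H]
  have hD : IsLocallyConstant D := by
    refine (IsLocallyConstant.iff_eventually_eq _).2 fun g => ?_
    have hc : Tendsto (fun h : G => g⁻¹ * h) (𝓝 g) (𝓝 1) := by
      have : Continuous fun h : G => g⁻¹ * h := by fun_prop
      simpa using this.tendsto g
    filter_upwards [hc (U.toOpenSubgroup.isOpen.mem_nhds U.toSubgroup.one_mem)] with h hh
    exact Subtype.ext (hDmk (QuotientGroup.eq.2 hh).symm)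
  have hDmul (g h : G) : D (g * h) = unop (ρM h) (D g) + D h := by
    refine Subtype.ext ?_
    change twist (insertFirst (g * h) F) =
      twist (translate h (twist (insertFirst g F))) + twist (insertFirst h F)
    rw [insertFirst_mul_of_δ_eq_zero hF, map_add, twist_twist, twist_translate_twist']
    exact add_comm _ _
  have hx : ∀ᶠ x in cofinite, ι x ∈ U.toSubgroup :=
    hG.tendsto (U.toOpenSubgroup.isOpen.mem_nhds U.toSubgroup.one_mem)
  -- Freeness lifts `D` along `twist`: prescribe on the basis the values of `D`, now read in `V`.
  -- They vanish for basis elements in `U`, hence for almost all of them.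
  obtain ⟨E, hE, hEmul, hEι⟩ := hG.crossed_exists ρV U hρV
    (fun x => ⟨twist (insertFirst (ι x) F), hDV _⟩) (by
      filter_upwards [hx] with x hx
      refine Subtype.ext ?_
      change twist (insertFirst (ι x) F) = 0
      rw [hDmk (h := 1) ((QuotientGroup.eq_one_iff _).2 hx), ← hK, sub_self])
  have hDE := hG.crossed_unique ρM U hρM hD
    (D' := fun g => ⟨twist (E g).1, hM (twist_mem_inflated (E g).2) (twist_twist _)⟩)
    (hE.comp fun f : V => (⟨twist f.1, hM (twist_mem_inflated f.2) (twist_twist _)⟩ : M)) hDmul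
    (fun g h => by
      refine Subtype.ext ?_
      change twist (E (g * h)).1 = twist (translate h (twist (E g).1)) + twist (E h).1
      rw [hEmul, twist_translate_twist', ← map_add]
      rfl)
    (fun x => by
      refine Subtype.ext ?_
      change twist (insertFirst (ι x) F) = twist (E (ι x)).1
      rw [hEι, twist_twist])
  have hDE' (g : G) : twist (insertFirst g F) = twist (E g).1 :=
    congrArg Subtype.val (congrFun hDE g)
  -- The trivialization of a crossed homomorphism into a coinduced module: evaluate `E (h 0)` at
  -- first argument `1`. By `he`, `E g` is the translate of `e` by `g` minus `e`.
  let e : Cochain p G (n + 1) :=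
    { toFun := fun h => (E (h 0)).1 (Fin.cons 1 fun i => h i.succ)
      continuous_toFun := by
        rw [continuous_iff_continuousAt]
        intro h
        have hc : Continuous fun h' : Fin (n + 1) → G =>
            (E (h 0)).1 (Fin.cons 1 fun i => h' i.succ) := by fun_prop
        refine hc.continuousAt.congr ?_
        have h0 : Tendsto (fun h' : Fin (n + 1) → G => h' 0) (𝓝 h) (𝓝 (h 0)) :=
          (continuous_apply 0).tendsto h
        filter_upwards [h0 ((IsLocallyConstant.iff_eventually_eq _).1 hE (h 0))] with h' hh'
        have hh' : E (h' 0) = E (h 0) := hh'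
        rw [hh'] }
  have he (g : G) : translate g e = (E g).1 + e := by
    ext h
    have h1 : translate g e h = (E (g * h 0)).1 (Fin.cons 1 fun i => h i.succ) := rfl
    rw [h1, hEmul]
    change (E g).1 (Fin.cons (h 0 * 1) (Fin.tail h)) + e h = (E g).1 h + e h
    rw [mul_one, Fin.cons_self_tail]
  -- Inserting `g` into the coboundary of this cochain gives `insertFirst 1 F + twist (E g)`, which
  -- is `insertFirst g F` by `hDE'` and `hK`.
  refine ⟨insertFirst 1 F - twist e, ext_insertFirst fun g => ?_⟩
  have h1 : twist (translate g (insertFirst 1 F)) = 0 := by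
    simpa using insertFirst_mul_of_δ_eq_zero hF 1 g
  rw [map_sub, map_sub, insertFirst_δ, insertFirst_δ, h1, twist_translate_twist', he, map_add,
    ← hDE', ← hK]
  abel

end CocyclesOfFree

/-! ### The structure relations for zero differential in the source and a dg algebra as target -/

section SignedOperations

open Finset

variable {k : Type u} [Field k]

/-- If the differential of `H` vanishes, then only the products of neighbours contribute to the
insertion sum. -/
theorem insertionSum_of_d_eq_zero (H : DGAlg.{u, v} k) (hd : H.d = 0) {B : Type w}
    [AddCommGroup B] [Module k B] (f : Operations k H.carrier B) (n : ℕ) (e : ℕ → ℤ)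
    (x : ℕ → H.carrier) :
    insertionSum f H.operations (n + 1) e x = ∑ r ∈ range n,
      (r : ℤ).negOnePow • f n fun j => splice r 2 (x r * x (r + 1)) x j := by
  have key (r : ℕ) (hr : r < n + 1) (s : ℕ) (hs : 1 ≤ s) (hs2 : s ≠ 2) (m : ℕ) (hm : r < m) :
      (f m fun j => splice r s (H.operations s fun i => x (r + i)) x j) = 0 := by
    refine (f m).map_coord_zero ⟨r, hm⟩ ?_
    simp only [splice, lt_irrefl, if_false, if_true]
    rcases (by omega : s = 1 ∨ 3 ≤ s) with rfl | h
    · rw [H.operations_one, hd]; rfl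
    · rw [H.operations_of_three_le h]; rfl
  unfold insertionSum
  -- The last position `r = n` leaves room only for `s = 1`, so it contributes nothing.
  rw [sum_range_succ, add_eq_left.2]
  · refine sum_congr rfl fun r hr => ?_
    rw [mem_range] at hr
    rw [sum_eq_single_of_mem 2 (by rw [mem_Icc]; omega)]
    · have h1 : r + 1 + (n + 1 - r - 2) = n := by omega
      have h2 (m m' : ℕ) (hm : m = m') (y : ℕ → H.carrier) :
          (f m fun j => y j) = f m' fun j => y j := by subst hm; rfl
      dsimp only
      rw [h2 _ _ h1, H.operations_two]
      congr 1
      -- The product has degree 0, so there is no Koszul sign, and `s t = 2 t` is even.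
      rw [show ((r : ℤ) + (2 : ℕ) * ((n + 1 - r - 2 : ℕ) : ℤ) + (2 - (2 : ℕ)) * ∑ i ∈ range r, e i)
        = r + 2 * ((n + 1 - r - 2 : ℕ) : ℤ) by push_cast; ring,
        Int.negOnePow_add, Int.negOnePow_even _ (even_two_mul _), mul_one]
    · intro s hs hs2
      rw [mem_Icc] at hs
      dsimp only
      rw [key r (by omega) s hs.1 hs2 _ (by omega), smul_zero]
  · refine sum_eq_zero fun s hs => ?_
    rw [mem_Icc] at hs
    dsimp only
    rw [key n (by omega) s hs.1 (by omega) _ (by omega), smul_zero]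

/-- The composition of `n + 1` into the two parts `i + 1` and `n - i`. -/
def twoPartComposition (n : ℕ) (i : Fin n) : Composition (n + 1) where
  blocks := [i + 1, n - i]
  blocks_pos := by
    intro j hj
    simp only [List.mem_cons, List.not_mem_nil, or_false] at hj
    omega
  blocks_sum := by
    simp only [List.sum_cons, List.sum_nil]
    omega

/-- Only the compositions with one or two parts contribute to the composition sum of a differential
graded algebra. -/
theorem compositionSum_dg (B : DGAlg.{u, w} k) {A : Type v} [AddCommGroup A] [Module k A]
    (f : Operations k A B.carrier) (n : ℕ) (e : ℕ → ℤ) (x : ℕ → A) :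
    compositionSum B.operations f (n + 1) e x = B.d (f (n + 1) fun j => x j) +
      ∑ i ∈ range n, ((i : ℤ) + (1 - ((n - i : ℕ) : ℤ)) * ∑ l ∈ range (i + 1), e l).negOnePow •
        ((f (i + 1) fun j => x j) * f (n - i) fun j => x (i + 1 + j)) := by
  classical
  have hinj : Function.Injective (twoPartComposition n) := fun i j h => by
    have := congrArg Composition.blocks h
    simp only [twoPartComposition, List.cons.injEq] at this
    omega
  have hne : Composition.single (n + 1) n.succ_pos ∉ univ.image (twoPartComposition n) := by
    intro h
    obtain ⟨i, -, hi⟩ := mem_image.1 h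
    have := congrArg Composition.length hi
    simp [Composition.length, twoPartComposition] at this
  unfold compositionSum
  rw [← sum_subset (subset_univ (insert (Composition.single (n + 1) n.succ_pos)
    (univ.image (twoPartComposition n)))), sum_insert hne, sum_image hinj.injOn]
  · congr 1
    · have h1 : (B.operations (Composition.single (n + 1) n.succ_pos).length fun j =>
          f ((Composition.single (n + 1) n.succ_pos).blocksFun j) fun i =>
            x ((Composition.single (n + 1) n.succ_pos).sizeUpTo j + i)) =
          B.d (f (n + 1) fun j => x j) := by
        refine (B.operations_one _).trans ?_
        simp only [Fin.val_zero, Composition.sizeUpTo_zero, zero_add]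
        rfl
      rw [h1]
      have : Unique (Fin (Composition.single (n + 1) n.succ_pos).length) :=
        inferInstanceAs (Unique (Fin 1))
      rw [Fintype.sum_unique]
      simp
    · rw [← Fin.sum_univ_eq_sum_range (fun i => ((i : ℤ) + (1 - ((n - i : ℕ) : ℤ)) *
        ∑ l ∈ range (i + 1), e l).negOnePow •
        ((f (i + 1) fun j => x j) * f (n - i) fun j => x (i + 1 + j))) n]
      refine sum_congr rfl fun i _ => ?_
      have hs0 : (twoPartComposition n i).sizeUpTo 0 = 0 := Composition.sizeUpTo_zero _
      have hs1 : (twoPartComposition n i).sizeUpTo 1 = i + 1 := by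
        simp [Composition.sizeUpTo, twoPartComposition]
      congr 1
      · refine congrArg Int.negOnePow ((Fin.sum_univ_two _).trans ?_)
        have hl : ((twoPartComposition n i).length : ℤ) = 2 := rfl
        have hb0 : (twoPartComposition n i).blocksFun (0 : Fin 2) = i + 1 := rfl
        have hb1 : (twoPartComposition n i).blocksFun (1 : Fin 2) = n - i := rfl
        rw [hl, hb0, hb1]
        simp only [Fin.val_zero, Fin.val_one, hs0, hs1]
        push_cast
        simp
      · refine (B.operations_two _).trans ?_
        simp only [Fin.val_zero, Fin.val_one, hs0, hs1, zero_add]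
        rfl
  · intro c _ hc
    have h3 : 3 ≤ c.length := by
      by_contra h
      apply hc
      have hpos : ∀ i ∈ c.blocks, 0 < i := fun i => c.blocks_pos
      have hsum := c.blocks_sum
      have hlen : c.blocks.length < 3 := not_le.1 h
      rw [mem_insert, mem_image]
      match hb : c.blocks with
      | [] => simp [hb] at hsum
      | [a] =>
        left
        ext1
        rw [hb] at hsum ⊢
        simpa [Composition.single] using hsum
      | [a, b] =>
        right
        rw [hb] at hsum hpos
        simp only [List.sum_cons, List.sum_nil] at hsum
        have ha := hpos a (by simp)
        have hb' := hpos b (by simp)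
        refine ⟨⟨a - 1, by omega⟩, mem_univ _, ?_⟩
        ext1
        rw [hb]
        simp only [twoPartComposition, List.cons.injEq, and_true]
        omega
      | _ :: _ :: _ :: _ =>
        rw [hb] at hlen
        simp only [List.length_cons] at hlen
        omega
    rw [B.operations_of_three_le h3]
    simp

end SignedOperations

/-! ### A universal defining system for Massey products -/

section Tower

open Finset Function

variable {k : Type u} [Field k] (B : DGAlg.{u, v} k) (h : B.carrier →ₗ[k] B.carrier)

/-- The multilinear operations defined by `T_1 = id` and
`T_n = h (∑_{i + j = n} T_i ⌣ T_j)`, evaluated at the first `n` terms of a sequence. -/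
def massey (n : ℕ) (y : ℕ → B.carrier) : B.carrier :=
  match n with
  | 0 => 0
  | 1 => y 0
  | n + 2 => h (∑ i : Fin (n + 1), massey (i + 1) y * massey (n + 1 - i) fun j => y (i + 1 + j))
termination_by n
decreasing_by all_goals omega

theorem massey_one (y : ℕ → B.carrier) : massey B h 1 y = y 0 := by
  rw [massey]

theorem massey_add_two (n : ℕ) (y : ℕ → B.carrier) : massey B h (n + 2) y =
    h (∑ i ∈ range (n + 1),
      massey B h (i + 1) y * massey B h (n + 1 - i) fun j => y (i + 1 + j)) := by
  rw [massey, ← Fin.sum_univ_eq_sum_range fun i =>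
    massey B h (i + 1) y * massey B h (n + 1 - i) fun j => y (i + 1 + j)]

theorem massey_congr {n : ℕ} {y z : ℕ → B.carrier} (H : ∀ j < n, y j = z j) :
    massey B h n y = massey B h n z := by
  induction n using Nat.strong_induction_on generalizing y z with
  | _ n ih =>
  match n with
  | 0 => rw [massey, massey]
  | 1 => rw [massey_one, massey_one, H 0 one_pos]
  | n + 2 =>
    rw [massey_add_two, massey_add_two]
    congr 1
    refine sum_congr rfl fun i hi => ?_
    rw [mem_range] at hi
    rw [ih (i + 1) (by omega) fun j hj => H j (by omega),
      ih (n + 1 - i) (by omega) fun j hj => H (i + 1 + j) (by omega)]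

/-- In each product of the recursion exactly one factor involves the slot `j`, and by induction it
does so linearly. This yields multilinearity and vanishing on a zero argument. -/
theorem massey_update {n j : ℕ} (hj : j < n) (y : ℕ → B.carrier) :
    ∃ L : B.carrier →ₗ[k] B.carrier, ∀ v, massey B h n (update y j v) = L v := by
  induction n using Nat.strong_induction_on generalizing y j with
  | _ n ih =>
  match n with
  | 0 => omega
  | 1 =>
    obtain rfl : j = 0 := by omega
    exact ⟨LinearMap.id, fun v => by simp [massey_one]⟩
  | n + 2 =>
    have hi (i : ℕ) : ∃ L : B.carrier →ₗ[k] B.carrier, i ∈ range (n + 1) → ∀ v,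
        (massey B h (i + 1) (update y j v) *
          massey B h (n + 1 - i) fun l => update y j v (i + 1 + l)) = L v := by
      by_cases hin : i ∈ range (n + 1)
      · have hin' := mem_range.1 hin
        by_cases hji : j < i + 1
        · obtain ⟨L, hL⟩ := ih (i + 1) (by omega) hji y
          refine ⟨LinearMap.mulRight k (massey B h (n + 1 - i) fun l => y (i + 1 + l)) ∘ₗ L,
            fun _ v => ?_⟩
          have : (fun l => update y j v (i + 1 + l)) = fun l => y (i + 1 + l) :=
            funext fun l => update_of_ne (by omega) _ _
          rw [hL, this]
          rfl
        · obtain ⟨L, hL⟩ := ih (n + 1 - i) (by omega) (j := j - (i + 1)) (by omega)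
            fun l => y (i + 1 + l)
          refine ⟨LinearMap.mulLeft k (massey B h (i + 1) y) ∘ₗ L, fun _ v => ?_⟩
          have h1 : (fun l => update y j v (i + 1 + l)) =
              update (fun l => y (i + 1 + l)) (j - (i + 1)) v := by
            funext l
            by_cases hl : i + 1 + l = j
            · obtain rfl : l = j - (i + 1) := by omega
              rw [hl, update_self, update_self]
            · rw [update_of_ne hl, update_of_ne (by omega)]
          rw [h1, hL, massey_congr B h (z := y) fun l hl => update_of_ne (by omega) _ _]
          rfl
      · exact ⟨0, fun hc => absurd hc hin⟩
    choose L hL using hi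
    refine ⟨h ∘ₗ ∑ i ∈ range (n + 1), L i, fun v => ?_⟩
    rw [massey_add_two, sum_congr rfl fun i hi => hL i hi v, LinearMap.comp_apply,
      LinearMap.sum_apply]

theorem massey_eq_zero {n j : ℕ} (hj : j < n) {y : ℕ → B.carrier} (hy : y j = 0) :
    massey B h n y = 0 := by
  obtain ⟨L, hL⟩ := massey_update B h hj y
  rw [← update_eq_self j y, hL, hy, map_zero]

variable {B h}

theorem massey_mem (hh : ∀ z, h z ∈ B.grading 1) {y : ℕ → B.carrier}
    (hy : ∀ j, y j ∈ B.grading 1) (n : ℕ) : massey B h n y ∈ B.grading 1 := by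
  match n with
  | 0 => rw [massey]; exact zero_mem _
  | 1 => rw [massey_one]; exact hy 0
  | n + 2 => rw [massey_add_two]; exact hh _

/-- As `h` inverts `d` on cocycles of degree 2, it suffices that `∑ T_i T_j` is closed. All `T_i`
have degree 1, so Leibniz and induction give a difference of two double sums of triple products,
which coincide by associativity. -/
theorem d_massey (hh : ∀ z, h z ∈ B.grading 1)
    (hd : ∀ z ∈ B.grading 2, B.d z = 0 → B.d (h z) = z) {y : ℕ → B.carrier}
    (hy : ∀ j, y j ∈ B.grading 1) (hdy : ∀ j, B.d (y j) = 0) (n : ℕ) :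
    B.d (massey B h (n + 1) y) =
      ∑ i ∈ range n, massey B h (i + 1) y * massey B h (n - i) fun j => y (i + 1 + j) := by
  induction n using Nat.strong_induction_on generalizing y with
  | _ n ih =>
  match n with
  | 0 => simp [massey_one, hdy]
  | n + 1 =>
    rw [massey_add_two]
    refine hd _ (sum_mem fun i _ => ?_) ?_
    · exact SetLike.GradedMul.mul_mem (A := B.grading) (massey_mem hh hy _)
        (massey_mem hh (fun j => hy _) _)
    · have hleib : ∀ i ∈ range (n + 1),
          B.d (massey B h (i + 1) y * massey B h (n + 1 - i) fun j => y (i + 1 + j)) =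
          (∑ a ∈ range i, massey B h (a + 1) y * (massey B h (i - a) fun j => y (a + 1 + j)) *
            massey B h (n + 1 - i) fun j => y (i + 1 + j)) -
          ∑ b ∈ Ico (i + 1) (n + 1), massey B h (i + 1) y *
            (massey B h (b - i) fun j => y (i + 1 + j)) *
            massey B h (n + 1 - b) fun j => y (b + 1 + j) := by
        intro i hi
        rw [mem_range] at hi
        have h2 := ih (n - i) (by omega) (y := fun j => y (i + 1 + j)) (fun j => hy _)
          fun j => hdy _
        rw [show n - i + 1 = n + 1 - i by omega] at h2
        rw [B.leibniz (massey_mem hh hy _), ih i hi hy hdy, h2, Int.negOnePow_one, Units.neg_smul,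
          one_smul, sum_mul, mul_sum, sub_eq_add_neg]
        congr 2
        rw [sum_Ico_eq_sum_range, show n + 1 - (i + 1) = n - i by omega]
        refine sum_congr rfl fun b hb => ?_
        rw [mem_range] at hb
        rw [mul_assoc, show i + 1 + b - i = b + 1 by omega,
          show n + 1 - (i + 1 + b) = n - i - b by omega]
        congr 4
        funext j
        congr 1
        omega
      rw [map_sum, sum_congr rfl hleib, sum_sub_distrib, sub_eq_zero]
      simp only [range_eq_Ico]
      -- Both double sums run over pairs of cut points, with the order of summation exchanged.
      refine sum_comm' fun i a => ?_
      simp only [mem_Ico]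
      omega

variable (B h)

/-- The multilinear map `(x_1, …, x_n) ↦ T_n (s x_1, …, s x_n)`. -/
def masseyMultilinear {H : Type w} [AddCommGroup H] [Module k H] (s : H →ₗ[k] B.carrier) (n : ℕ) :
    MultilinearMap k (fun _ : Fin n => H) B.carrier :=
  have key [DecidableEq (Fin n)] (m : Fin n → H) (i : Fin n) : ∃ L : H →ₗ[k] B.carrier, ∀ v,
      (massey B h n fun j => if hj : j < n then s (update m i v ⟨j, hj⟩) else 0) = L v := by
    obtain ⟨L, hL⟩ := massey_update B h i.2 fun j => if hj : j < n then s (m ⟨j, hj⟩) else 0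
    refine ⟨L ∘ₗ s, fun v => ?_⟩
    rw [LinearMap.comp_apply, ← hL]
    congr 1
    funext j
    by_cases hji : j = i
    · subst hji; simp
    · rw [update_of_ne hji]
      split_ifs with hj
      · rw [update_of_ne]
        exact fun hc => hji (congrArg Fin.val hc)
      · rfl
  -- The padding by `0` is harmless: only the first `n` terms enter.
  { toFun := fun m => massey B h n fun j => if hj : j < n then s (m ⟨j, hj⟩) else 0
    map_update_add' := fun m i v w => by
      obtain ⟨L, hL⟩ := key m i
      rw [hL, hL, hL, map_add]
    map_update_smul' := fun m i c v => by
      obtain ⟨L, hL⟩ := key m i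
      rw [hL, hL, map_smul] }

theorem masseyMultilinear_apply {H : Type w} [AddCommGroup H] [Module k H]
    (s : H →ₗ[k] B.carrier) (n : ℕ) (x : ℕ → H) :
    (masseyMultilinear B h s n fun j => x j) = massey B h n fun j => s (x j) := by
  refine massey_congr B h fun j hj => ?_
  simp [hj]

end Tower

/-! ### The `A_∞`-morphism and its signs -/

section FormalityMap

open Finset Function

variable {k : Type u} [Field k]

/-- The sign `(-1)^{n (n - 1) / 2}`. -/
def triangleSign (n : ℕ) : ℤˣ := (n.choose 2 : ℤ).negOnePow

theorem triangleSign_one : triangleSign 1 = 1 := rfl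

/-- The exponent counts pairs: those inside either block, and the `i j` pairs across. -/
theorem triangleSign_add (i j : ℕ) :
    triangleSign (i + j) = triangleSign i * triangleSign j * ((i : ℤ) * j).negOnePow := by
  have h : (i + j).choose 2 = i.choose 2 + j.choose 2 + i * j := by
    induction j with
    | zero => simp
    | succ j ih =>
      rw [← add_assoc, Nat.choose_succ_succ' (i + j) 1, Nat.choose_succ_succ' j 1, ih,
        Nat.choose_one_right, Nat.choose_one_right]
      ring
  rw [triangleSign, h]
  push_cast
  rw [Int.negOnePow_add, Int.negOnePow_add]
  rfl

theorem splice_eq_update {A : Type v} (r s : ℕ) (v w : A) (x : ℕ → A) :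
    splice r s v x = update (splice r s w x) r v := by
  funext j
  by_cases hj : j = r
  · subst hj; simp [splice]
  · rw [update_of_ne hj]; simp [splice, hj]

theorem map_splice {A : Type v} {B : Type w} (f : A → B) (r s : ℕ) (v : A) (x : ℕ → A) :
    (fun j => f (splice r s v x j)) = splice r s (f v) fun j => f (x j) := by
  funext j
  unfold splice
  split_ifs <;> rfl

/-- Omit the term number `r` of a sequence. -/
def omitTerm {A : Type v} (r : ℕ) (x : ℕ → A) (j : ℕ) : A := if j < r then x j else x (j + 1)

theorem splice_two_succ {A : Type v} (r : ℕ) (x : ℕ → A) :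
    splice r 2 (x (r + 1)) x = omitTerm r x := by
  funext j
  unfold splice omitTerm
  split_ifs <;> first | rfl | (congr 1; omega)

theorem splice_two_self {A : Type v} (r : ℕ) (x : ℕ → A) :
    splice r 2 (x r) x = omitTerm (r + 1) x := by
  funext j
  unfold splice omitTerm
  split_ifs <;> first | rfl | omega | (congr 1; omega)

theorem sum_range_negOnePow_telescope {M : Type v} [AddCommGroup M] (P : ℕ → M) (n : ℕ) :
    ∑ r ∈ range n, (r : ℤ).negOnePow • (P r + P (r + 1)) = P 0 - (n : ℤ).negOnePow • P n := by
  induction n with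
  | zero => simp
  | succ n ih =>
    rw [sum_range_succ, ih, smul_add]
    push_cast
    rw [Int.negOnePow_succ, Units.neg_smul]
    abel

variable {B : DGAlg.{u, v} k} {h : B.carrier →ₗ[k] B.carrier}

/-- Linearity in slot `r`: replacing two neighbours by one of them amounts to omitting the other. -/
theorem massey_splice {n r : ℕ} (hr : r < n) (a b : k) (y : ℕ → B.carrier) :
    massey B h n (splice r 2 (a • y (r + 1) + b • y r) y) =
      a • massey B h n (omitTerm r y) + b • massey B h n (omitTerm (r + 1) y) := by
  obtain ⟨L, hL⟩ := massey_update B h hr (splice r 2 0 y)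
  rw [← splice_two_succ, ← splice_two_self, splice_eq_update r 2 _ 0,
    splice_eq_update r 2 (y (r + 1)) 0, splice_eq_update r 2 (y r) 0, hL, hL, hL, map_add, map_smul,
    map_smul]

variable {H : DGAlg.{u, w} k} {ε : H.carrier →ₗ[k] k} {s : H.carrier →ₗ[k] B.carrier}

variable (h ε s) in
/-- The components of the morphism from the cohomology algebra: `f_1 = ε + s` and
`f_n = ± T_n s^{⊗ n}`. -/
noncomputable def formalityMap : Operations k H.carrier B.carrier
  | 1 => MultilinearMap.ofSubsingleton k H.carrier B.carrier 0
      (LinearMap.toSpanSingleton k B.carrier 1 ∘ₗ ε + s)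
  | n => triangleSign n • masseyMultilinear B h s n

theorem formalityMap_apply (n : ℕ) (x : ℕ → H.carrier) :
    (formalityMap h ε s n fun j => x j) = triangleSign n • massey B h n (fun j => s (x j)) +
      if n = 1 then ε (x 0) • 1 else 0 := by
  match n with
  | 0 =>
    rw [if_neg zero_ne_one, add_zero, ← masseyMultilinear_apply]
    rfl
  | 1 =>
    rw [if_pos rfl, triangleSign_one, one_smul, massey_one, add_comm]
    rfl
  | n + 2 =>
    rw [if_neg (by omega), add_zero, ← masseyMultilinear_apply]
    rfl

theorem negOnePow_smul_mem {i : ℤ} {A : DGAlg.{u, v} k} (z : ℤˣ) {x : A.carrier}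
    (hx : x ∈ A.grading i) : z • x ∈ A.grading i := by
  rcases Int.units_eq_one_or z with rfl | rfl
  · rwa [one_smul]
  · rw [Units.neg_smul, one_smul]; exact neg_mem hx

/-- The tower takes values in degree 1 and vanishes unless all `n` inputs have degree 1, in which
case the required degree is `n + (1 - n) = 1`. The augmentation only sees degree 0. -/
theorem formalityMap_hasDegree (hh : ∀ z, h z ∈ B.grading 1) (hs : ∀ x, s x ∈ B.grading 1)
    (hε0 : ∀ i ≠ 0, ∀ x ∈ H.grading i, ε x = 0) (hs0 : ∀ i ≠ 1, ∀ x ∈ H.grading i, s x = 0)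
    (N : ℕ∞) : (formalityMap h ε s).HasDegree H.grading B.grading 1 N := by
  intro n hn _ e x hx
  obtain ⟨y, rfl⟩ : ∃ y : ℕ → H.carrier, x = fun j : Fin n => y j :=
    ⟨fun j => if hj : j < n then x ⟨j, hj⟩ else 0, by funext j; simp⟩
  rw [formalityMap_apply]
  refine add_mem ?_ ?_
  · by_cases he : ∀ i, e i = 1
    · have hsum : ∑ i, e i + (1 - n : ℤ) = 1 := by simp [he]
      rw [hsum]
      exact negOnePow_smul_mem _ (massey_mem hh (fun j => hs _) n)
    · push Not at he
      obtain ⟨i, hi⟩ := he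
      rw [massey_eq_zero B h i.2 (hs0 _ hi _ (hx i)), smul_zero]
      exact zero_mem _
  · split_ifs with h1
    · subst h1
      by_cases he : e 0 = 0
      · simp only [univ_unique, Fin.default_eq_zero, Fin.isValue, sum_singleton, Nat.cast_one,
          sub_self, add_zero, he]
        exact Submodule.smul_mem _ _ (SetLike.GradedOne.one_mem (A := B.grading))
      · rw [show ε (y 0) = 0 from hε0 _ he _ (hx 0), zero_smul]
        exact zero_mem _
    · exact zero_mem _

/-- By `hsmul`, multiplying the neighbours `x r` and `x (r + 1)` produces `P r + P (r + 1)`, where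
`P r` weights the tower without `x r` by `ε (x r)`. The alternating sum telescopes to its end terms.
On the right these are the products with the `ε`-part of `f_1` at either end, while the other
products cancel against `d T` by `d_massey`. For two inputs a scalar term `ε (x 0) ε (x 1)` is added
on both sides. -/
theorem formalityMap_relation (hh : ∀ z, h z ∈ B.grading 1)
    (hhd : ∀ z ∈ B.grading 2, B.d z = 0 → B.d (h z) = z)
    (hs : ∀ x, s x ∈ B.grading 1) (hds : ∀ x, B.d (s x) = 0) (hd : H.d = 0)
    (hε0 : ∀ i ≠ 0, ∀ x ∈ H.grading i, ε x = 0) (hs0 : ∀ i ≠ 1, ∀ x ∈ H.grading i, s x = 0)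
    (hεmul : ∀ i j, ∀ x ∈ H.grading i, ∀ y ∈ H.grading j, ε (x * y) = ε x * ε y)
    (hsmul : ∀ i j, ∀ x ∈ H.grading i, ∀ y ∈ H.grading j, s (x * y) = ε x • s y + ε y • s x)
    (n : ℕ) (e : ℕ → ℤ) (x : ℕ → H.carrier) (hx : ∀ i, x i ∈ H.grading (e i)) :
    insertionSum (formalityMap h ε s) H.operations (n + 1) e x =
      compositionSum B.operations (formalityMap h ε s) (n + 1) e x := by
  have hdε (c : k) : B.d (c • 1) = 0 := by rw [map_smul, B.d_one, smul_zero]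
  have hdsign (z : ℤˣ) (b : B.carrier) : B.d (z • b) = z • B.d b := by
    rw [Units.smul_def, Units.smul_def, map_zsmul]
  have hmulsign (z z' : ℤˣ) (b b' : B.carrier) : (z • b) * (z' • b') = (z * z') • (b * b') := by
    rw [smul_mul_smul_comm]
  set y : ℕ → B.carrier := fun j => s (x j) with hy
  have happly (m i : ℕ) : (formalityMap h ε s m fun j => x (i + j)) =
      triangleSign m • massey B h m (fun j => y (i + j)) +
        if m = 1 then ε (x (i + 0)) • 1 else 0 := formalityMap_apply m fun j => x (i + j)
  rw [insertionSum_of_d_eq_zero H hd, compositionSum_dg]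
  simp only [formalityMap_apply, happly]
  match n with
  | 0 => simp [triangleSign_one, massey_one, hds, hdε]
  | n + 1 =>
    let P : ℕ → B.carrier := fun r => ε (x r) • massey B h (n + 1) (omitTerm r y)
    have hL : ∀ r ∈ range (n + 1), ((r : ℤ).negOnePow •
        (triangleSign (n + 1) • massey B h (n + 1)
          (fun j => s (splice r 2 (x r * x (r + 1)) x j)) +
          if n + 1 = 1 then ε (splice r 2 (x r * x (r + 1)) x 0) • (1 : B.carrier) else 0)) =
        triangleSign (n + 1) • ((r : ℤ).negOnePow • (P r + P (r + 1))) +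
          if r = 0 then (if r = n then (ε (x 0) * ε (x (n + 1))) • (1 : B.carrier) else 0)
            else 0 := by
      intro r hr
      rw [mem_range] at hr
      have hm : massey B h (n + 1) (splice r 2
          (ε (x r) • s (x (r + 1)) + ε (x (r + 1)) • s (x r)) fun j => s (x j)) =
          P r + P (r + 1) := massey_splice hr _ _ y
      rw [map_splice, hsmul _ _ _ (hx r) _ (hx (r + 1)), hm, smul_add]
      congr 1
      · rw [smul_comm]
      · by_cases hn : n = 0
        · subst hn
          obtain rfl : r = 0 := by omega
          simp [splice, hεmul _ _ _ (hx 0) _ (hx 1)]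
        · rw [if_neg (by omega), smul_zero]
          split_ifs <;> first | omega | rfl
    -- When all inputs have degree 1, this is the sign rule `triangleSign_add`; otherwise some `y j`
    -- is zero and both sides vanish.
    have hA : ∀ i ∈ range (n + 1), (((i : ℤ) + (1 - ((n + 1 - i : ℕ) : ℤ)) *
        ∑ l ∈ range (i + 1), e l).negOnePow •
        ((triangleSign (i + 1) • massey B h (i + 1) y) *
          (triangleSign (n + 1 - i) • massey B h (n + 1 - i) fun j => y (i + 1 + j)))) =
        -(triangleSign (n + 2) • (massey B h (i + 1) y *
          massey B h (n + 1 - i) fun j => y (i + 1 + j))) := by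
      intro i hi
      rw [mem_range] at hi
      by_cases he : ∀ j < n + 2, e j = 1
      · have hsum : ∑ l ∈ range (i + 1), e l = i + 1 := by
          rw [sum_congr rfl fun l hl => he l (by rw [mem_range] at hl; omega)]
          simp
        have h2 := triangleSign_add (i + 1) (n + 1 - i)
        rw [show i + 1 + (n + 1 - i) = n + 2 by omega] at h2
        rw [hmulsign, smul_smul, hsum, h2, ← Units.neg_smul]
        congr 1
        have h3 : ((i : ℤ) + (1 - ((n + 1 - i : ℕ) : ℤ)) * (i + 1)).negOnePow =
            -(((i + 1 : ℕ) : ℤ) * ((n + 1 - i : ℕ) : ℤ)).negOnePow := by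
          rw [← Int.negOnePow_succ, Int.negOnePow_eq_iff]
          -- Half of the difference of the two exponents.
          refine ⟨i - (i + 1) * ((n + 1 - i : ℕ) : ℤ), ?_⟩
          push_cast
          ring
        rw [h3, mul_comm, mul_neg]
      · push Not at he
        obtain ⟨j, hj, hje⟩ := he
        have hyj : y j = 0 := hs0 _ hje _ (hx j)
        by_cases hji : j < i + 1
        · rw [massey_eq_zero B h hji hyj]
          simp
        · rw [massey_eq_zero B h (n := n + 1 - i) (j := j - (i + 1)) (by omega)
            (y := fun j => y (i + 1 + j)) (by rw [← hyj]; congr 1; omega)]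
          simp
    have hR : ∀ i ∈ range (n + 1), (((i : ℤ) + (1 - ((n + 1 - i : ℕ) : ℤ)) *
        ∑ l ∈ range (i + 1), e l).negOnePow •
        ((triangleSign (i + 1) • massey B h (i + 1) y +
            if i + 1 = 1 then ε (x 0) • (1 : B.carrier) else 0) *
          (triangleSign (n + 1 - i) • (massey B h (n + 1 - i) fun j => y (i + 1 + j)) +
            if n + 1 - i = 1 then ε (x (i + 1 + 0)) • (1 : B.carrier) else 0))) =
        -(triangleSign (n + 2) • (massey B h (i + 1) y *
          massey B h (n + 1 - i) fun j => y (i + 1 + j))) +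
        (if i = 0 then triangleSign (n + 1) • P 0 else 0) +
        (if i = n then triangleSign (n + 1) • ((n : ℤ).negOnePow • P (n + 1)) else 0) +
        (if i = 0 then (if i = n then (ε (x 0) * ε (x (n + 1))) • (1 : B.carrier) else 0)
            else 0) := by
      intro i hi
      rw [← hA i hi, add_mul, mul_add, mul_add, smul_add, smul_add, smul_add]
      rw [mem_range] at hi
      have hPn : P (n + 1) = ε (x (n + 1)) • massey B h (n + 1) y := by
        refine congrArg _ (massey_congr B h fun j hj => ?_)
        simp [omitTerm, hj]
      have hP0 : P 0 = ε (x 0) • massey B h (n + 1) fun j => y (0 + 1 + j) := by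
        refine congrArg _ (massey_congr B h fun j hj => ?_)
        simp [omitTerm, add_comm]
      -- The Koszul sign is trivial if `x 0` has degree 0; otherwise `ε (x 0) = 0`.
      have hsgn0 (b : B.carrier) : (((0 : ℕ) : ℤ) + (1 - ((n + 1 - 0 : ℕ) : ℤ)) *
          ∑ l ∈ range (0 + 1), e l).negOnePow • ε (x 0) • b = ε (x 0) • b := by
        by_cases he : e 0 = 0
        · simp [he]
        · rw [hε0 _ he _ (hx 0), zero_smul, smul_zero]
      have hsgnn : ((n : ℤ) + (1 - ((n + 1 - n : ℕ) : ℤ)) *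
          ∑ l ∈ range (n + 1), e l).negOnePow = (n : ℤ).negOnePow := by
        simp
      have e1 (c : k) (z : ℤˣ) (b : B.carrier) : (c • 1) * (z • b) = c • (z • b) := by
        rw [smul_mul_assoc, one_mul]
      have e2 (c : k) (z : ℤˣ) (b : B.carrier) : (z • b) * (c • 1) = z • (c • b) := by
        rw [mul_smul_comm, mul_one, smul_comm]
      have e3 (c c' : k) : (c • (1 : B.carrier)) * (c' • 1) = c • c' • (1 : B.carrier) := by
        rw [smul_mul_assoc, one_mul]
      -- The `ε`-part needs a block of length 1: the second block in `t1`, the first in `t2`, both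
      -- in `t3`.
      have t1 : (((i : ℤ) + (1 - ((n + 1 - i : ℕ) : ℤ)) * ∑ l ∈ range (i + 1), e l).negOnePow •
          ((triangleSign (i + 1) • massey B h (i + 1) y) *
            if n + 1 - i = 1 then ε (x (i + 1 + 0)) • (1 : B.carrier) else 0)) =
          if i = n then triangleSign (n + 1) • ((n : ℤ).negOnePow • P (n + 1)) else 0 := by
        by_cases h1 : i = n
        · subst h1
          rw [if_pos (by omega), if_pos rfl, e2, hsgnn, hPn, smul_comm]
        · rw [if_neg (by omega), if_neg h1, mul_zero, smul_zero]
      have t2 : (((i : ℤ) + (1 - ((n + 1 - i : ℕ) : ℤ)) * ∑ l ∈ range (i + 1), e l).negOnePow •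
          ((if i + 1 = 1 then ε (x 0) • (1 : B.carrier) else 0) *
            (triangleSign (n + 1 - i) • massey B h (n + 1 - i) fun j => y (i + 1 + j)))) =
          if i = 0 then triangleSign (n + 1) • P 0 else 0 := by
        by_cases h0 : i = 0
        · subst h0
          rw [if_pos rfl, if_pos rfl, e1, hsgn0, hP0, Nat.sub_zero, smul_comm (ε (x 0))]
        · rw [if_neg (by omega), if_neg h0, zero_mul, smul_zero]
      have t3 : (((i : ℤ) + (1 - ((n + 1 - i : ℕ) : ℤ)) * ∑ l ∈ range (i + 1), e l).negOnePow •
          ((if i + 1 = 1 then ε (x 0) • (1 : B.carrier) else 0) *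
            if n + 1 - i = 1 then ε (x (i + 1 + 0)) • (1 : B.carrier) else 0)) =
          if i = 0 then (if i = n then (ε (x 0) * ε (x (n + 1))) • (1 : B.carrier) else 0)
            else 0 := by
        by_cases h0 : i = 0
        · subst h0
          by_cases h1 : 0 = n
          · subst h1
            rw [if_pos rfl, if_pos rfl, if_pos rfl, if_pos rfl, e3, hsgn0, mul_smul]
          · rw [if_neg (c := n + 1 - 0 = 1) (by omega), if_pos rfl, if_neg h1, mul_zero,
              smul_zero, if_pos rfl]
        · rw [if_neg (by omega), if_neg h0, zero_mul, smul_zero]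
      rw [t1, t2, t3]
      abel
    have hdT : B.d (massey B h (n + 1 + 1) fun j => s (x j)) = ∑ i ∈ range (n + 1),
        massey B h (i + 1) y * massey B h (n + 1 - i) fun j => y (i + 1 + j) :=
      d_massey hh hhd (fun j => hs _) (fun j => hds _) _
    rw [sum_congr rfl hL, if_neg (by omega), add_zero, hdsign, hdT]
    refine Eq.trans ?_ (congrArg _ (sum_congr rfl hR).symm)
    rw [sum_add_distrib, sum_add_distrib, sum_add_distrib, sum_add_distrib, ← smul_sum,
      sum_range_negOnePow_telescope, sum_neg_distrib, ← smul_sum]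
    simp only [sum_ite_eq', mem_range, n.succ_pos, lt_add_one, if_true]
    push_cast
    rw [Int.negOnePow_succ, Units.neg_smul, sub_neg_eq_add, smul_add]
    abel

end FormalityMap

/-! ### Formality when the cohomology is of free type -/

/-- A graded algebra is a differential graded algebra with zero differential. -/
def GradedAlg.withZeroDifferential {k : Type u} [Field k] (H : GradedAlg.{u, v} k) :
    DGAlg.{u, v} k :=
  { H with
    d := 0
    d_mem := fun _ => zero_mem _
    d_d := fun _ => rfl
    leibniz := fun _ _ => by simp }

/-- A graded algebra is of the type of the cohomology of a free group if it is nonzero and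
concentrated in the degrees `0` and `1`, and its degree `0` part consists of the scalars. -/
structure GradedAlg.IsFreeType {k : Type u} [Field k] (H : GradedAlg.{u, v} k) : Prop where
  one_ne_zero : (1 : H.carrier) ≠ 0
  exists_smul_one : ∀ x ∈ H.grading 0, ∃ c : k, x = c • 1
  eq_zero : ∀ i, i ≠ 0 → i ≠ 1 → ∀ x ∈ H.grading i, x = 0

theorem GradedAlg.IsFreeType.of_iso {k : Type u} [Field k] {H : GradedAlg.{u, v} k}
    {K : GradedAlg.{u, w} k} (hK : K.IsFreeType) (φ : H.Iso K) : H.IsFreeType where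
  one_ne_zero h := hK.one_ne_zero (by rw [← map_one φ.toAlgEquiv, h, map_zero])
  exists_smul_one x hx := by
    obtain ⟨c, hc⟩ := hK.exists_smul_one _ ((φ.mem_iff 0 x).2 hx)
    exact ⟨c, φ.toAlgEquiv.injective (by rw [hc, map_smul, map_one])⟩
  eq_zero i h0 h1 x hx :=
    φ.toAlgEquiv.injective (by rw [hK.eq_zero i h0 h1 _ ((φ.mem_iff i x).2 hx), map_zero])

namespace DGAlg

variable {k : Type u} [Field k] (B : DGAlg.{u, v} k)

theorem classMap_eq_zero_iff (z : B.cocycles) : B.classMap z = 0 ↔ ∃ y, B.d y = z :=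
  Ideal.Quotient.eq_zero_iff_mem (I := B.coboundaries)

/-- A linear choice of primitives for the cocycles of degree `2`. -/
theorem exists_homotopy (h2 : ∀ x ∈ B.cohomology.grading 2, x = 0) :
    ∃ h : B.carrier →ₗ[k] B.carrier, (∀ z, h z ∈ B.grading 1) ∧
      ∀ z ∈ B.grading 2, B.d z = 0 → B.d (h z) = z := by
  let Z : Submodule k B.carrier := B.grading 2 ⊓ LinearMap.ker B.d
  let D : B.grading 1 →ₗ[k] Z :=
    (B.d ∘ₗ (B.grading 1).subtype).codRestrict Z fun x => ⟨B.d_mem x.2, B.d_d _⟩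
  have hD : LinearMap.range D = ⊤ := by
    rw [LinearMap.range_eq_top]
    rintro ⟨z, hz, hdz⟩
    obtain ⟨y, hy⟩ := (B.classMap_eq_zero_iff ⟨z, hdz⟩).1 (h2 _ ⟨⟨z, hdz⟩, hz, rfl⟩)
    -- The primitive `y` may be inhomogeneous; its component of degree 1 is a primitive too.
    refine ⟨⟨B.proj 1 y, B.proj_mem 1 y⟩, Subtype.ext ?_⟩
    change B.d (B.proj 1 y) = z
    rw [← B.proj_d, hy]
    exact B.proj_same hz
  -- A linear section of `d` onto the cocycles of degree 2, extended arbitrarily to all of `B`.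
  obtain ⟨g, hg⟩ := D.exists_rightInverse_of_surjective hD
  obtain ⟨g', hg'⟩ := g.exists_extend
  refine ⟨(B.grading 1).subtype ∘ₗ g', fun z => (g' z).2, fun z hz hdz => ?_⟩
  have h1 : g' z = g ⟨z, hz, hdz⟩ := LinearMap.congr_fun hg' ⟨z, hz, hdz⟩
  rw [LinearMap.comp_apply, h1]
  exact congrArg Subtype.val (LinearMap.congr_fun hg ⟨z, hz, hdz⟩)

/-- A linear choice of representatives for the cohomology classes of degree `1`. -/
theorem exists_representatives :
    ∃ s : B.cohomology.carrier →ₗ[k] B.carrier, ∃ hd : ∀ x, B.d (s x) = 0,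
      (∀ x, s x ∈ B.grading 1) ∧ (∀ i ≠ 1, ∀ x ∈ B.cohomology.grading i, s x = 0) ∧
      ∀ x ∈ B.cohomology.grading 1, B.classMap ⟨s x, hd x⟩ = x := by
  let H := B.cohomology.withZeroDifferential
  let c : B.cocyclesGrading 1 →ₗ[k] B.cohomology.grading 1 :=
    (B.classMap.toLinearMap ∘ₗ (B.cocyclesGrading 1).subtype).codRestrict _
      fun z => ⟨z.1, z.2, rfl⟩
  have hc : LinearMap.range c = ⊤ := by
    rw [LinearMap.range_eq_top]
    rintro ⟨_, z, hz, rfl⟩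
    exact ⟨⟨z, hz⟩, rfl⟩
  -- A linear section on `H^1`, precomposed below with the projection to degree 1 so that it
  -- vanishes in all other degrees.
  obtain ⟨g, hg⟩ := c.exists_rightInverse_of_surjective hc
  let π : B.cohomology.carrier →ₗ[k] B.cohomology.grading 1 :=
    (H.proj 1).codRestrict (B.cohomology.grading 1) (H.proj_mem 1)
  refine ⟨B.cocycles.val.toLinearMap ∘ₗ (B.cocyclesGrading 1).subtype ∘ₗ g ∘ₗ π,
    fun x => (g (π x)).1.2, fun x => (g (π x)).2, fun i hi x hx => ?_, fun x hx => ?_⟩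
  · have : π x = 0 := Subtype.ext (H.proj_ne hi hx)
    rw [LinearMap.comp_apply, LinearMap.comp_apply, LinearMap.comp_apply, this, map_zero, map_zero,
      map_zero]
  · have : π x = ⟨x, hx⟩ := Subtype.ext (H.proj_same hx)
    have h2 : c (g (π x)) = π x := LinearMap.congr_fun hg (π x)
    exact (congrArg Subtype.val h2).trans (congrArg Subtype.val this)

/-- The augmentation of a graded algebra that is concentrated in the degrees `0` and `1`, with the
scalars in degree `0`. -/
theorem exists_augmentation (H : DGAlg.{u, v} k) (hH : H.toGradedAlg.IsFreeType) :
    ∃ ε : H.carrier →ₗ[k] k, (∀ i ≠ 0, ∀ x ∈ H.grading i, ε x = 0) ∧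
      ∀ x ∈ H.grading 0, x = ε x • 1 := by
  obtain ⟨l, hl⟩ := (LinearMap.toSpanSingleton k H.carrier 1).exists_leftInverse_of_injective
    (LinearMap.ker_toSpanSingleton k hH.one_ne_zero)
  have hl1 : l 1 = 1 := by simpa using LinearMap.congr_fun hl 1
  refine ⟨l ∘ₗ H.proj 0, fun i hi x hx => ?_, fun x hx => ?_⟩
  · rw [LinearMap.comp_apply, H.proj_ne hi hx, map_zero]
  · rw [LinearMap.comp_apply, H.proj_same hx]
    obtain ⟨c, rfl⟩ := hH.exists_smul_one x hx
    rw [map_smul, hl1, smul_eq_mul, mul_one]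

variable {B}

/-- The augmentation and a linear map that vanishes outside of degree `1` on products. -/
theorem augmentation_mul {H : DGAlg.{u, v} k} (hH : H.toGradedAlg.IsFreeType)
    {ε : H.carrier →ₗ[k] k}
    (hε0 : ∀ i ≠ 0, ∀ x ∈ H.grading i, ε x = 0) (hε : ∀ x ∈ H.grading 0, x = ε x • 1)
    {M : Type w} [AddCommGroup M] [Module k M] {s : H.carrier →ₗ[k] M}
    (hs0 : ∀ i ≠ 1, ∀ x ∈ H.grading i, s x = 0) {i j : ℤ} {x y : H.carrier}
    (hx : x ∈ H.grading i) (hy : y ∈ H.grading j) :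
    ε (x * y) = ε x * ε y ∧ s (x * y) = ε x • s y + ε y • s x := by
  by_cases hi : i = 0
  · subst hi
    have hxy : x * y = ε x • y := by
      conv_lhs => rw [hε x hx]
      rw [smul_mul_assoc, one_mul]
    rw [hxy, hs0 0 zero_ne_one x hx, smul_zero, add_zero, map_smul, map_smul, smul_eq_mul]
    exact ⟨rfl, rfl⟩
  by_cases hj : j = 0
  · subst hj
    have hxy : x * y = ε y • x := by
      conv_lhs => rw [hε y hy]
      rw [mul_smul_comm, mul_one]
    rw [hxy, hs0 0 zero_ne_one y hy, smul_zero, zero_add, map_smul, map_smul, smul_eq_mul,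
      mul_comm]
    exact ⟨rfl, rfl⟩
  -- With no factor in degree 0, only two factors of degree 1 could matter, and their product lies
  -- in the vanishing degree 2.
  have hxy : x * y = 0 := by
    by_cases hi1 : i = 1
    · by_cases hj1 : j = 1
      · subst hi1 hj1
        exact hH.eq_zero 2 two_ne_zero (by decide) _
          (SetLike.GradedMul.mul_mem (A := H.grading) hx hy)
      · rw [hH.eq_zero j hj hj1 y hy, mul_zero]
    · rw [hH.eq_zero i hi hi1 x hx, zero_mul]
  rw [hxy, hε0 i hi x hx, hε0 j hj y hy, zero_smul, zero_smul, add_zero, zero_mul, map_zero,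
    map_zero]
  exact ⟨rfl, rfl⟩

/-- Formality from a choice of representatives and of a homotopy. -/
theorem isFormal_of_representatives {H : DGAlg.{u, v} k} (hHd : H.d = 0)
    (hH : H.toGradedAlg.IsFreeType)
    {h : B.carrier →ₗ[k] B.carrier} (hh : ∀ z, h z ∈ B.grading 1)
    (hhd : ∀ z ∈ B.grading 2, B.d z = 0 → B.d (h z) = z)
    {q : B.cocycles →ₗ[k] H.carrier} (hq1 : q 1 = 1) (hq : ∀ z, q z = 0 ↔ ∃ y, B.d y = z)
    {s : H.carrier →ₗ[k] B.carrier} (hds : ∀ x, B.d (s x) = 0) (hs : ∀ x, s x ∈ B.grading 1)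
    (hs0 : ∀ i ≠ 1, ∀ x ∈ H.grading i, s x = 0)
    (hqs : ∀ x ∈ H.grading 1, q ⟨s x, hds x⟩ = x) (N : ℕ∞) : B.IsFormal N := by
  obtain ⟨ε, hε0, hε⟩ := H.exists_augmentation hH
  -- This is `f_1` with values in the cocycles. It is a section of the class map `q` (`hqf`), hence
  -- bijective on cohomology.
  let f : H.carrier →ₗ[k] B.cocycles :=
    s.codRestrict (Subalgebra.toSubmodule B.cocycles) hds +
      LinearMap.toSpanSingleton k B.cocycles 1 ∘ₗ ε
  have hf (x : H.carrier) : (f x : B.carrier) = s x + ε x • 1 := rfl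
  have hf1 (x : H.carrier) : (formalityMap h ε s 1 fun _ => x) = f x := by
    have := formalityMap_apply (h := h) (ε := ε) (s := s) 1 fun _ => x
    rw [if_pos rfl, massey_one, triangleSign_one, one_smul] at this
    exact this
  have hqf (x : H.carrier) : q (f x) = x := by
    induction x using H.hom_induction with
    | mem i x hx =>
      by_cases h1 : i = 1
      · subst h1
        have : f x = ⟨s x, hds x⟩ := Subtype.ext (by
          rw [hf, hε0 1 one_ne_zero x hx, zero_smul, add_zero])
        rw [this, hqs x hx]
      · by_cases h0 : i = 0
        · subst h0
          have : f x = ε x • 1 := Subtype.ext (by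
            rw [hf, hs0 0 zero_ne_one x hx, zero_add]; rfl)
          rw [this, map_smul, hq1, ← hε x hx]
        · rw [hH.eq_zero i h0 h1 x hx, map_zero, map_zero]
    | add x y hx hy => rw [map_add, map_add, hx, hy]
  refine ⟨⟨H.toAnAlg N, ?_, ⟨formalityMap h ε s, formalityMap_hasDegree hh hs hε0 hs0 N, ?_⟩, ?_⟩,
    fun n hn _ => H.operations_of_three_le hn⟩
  · ext x
    refine (H.operations_one x).trans ?_
    rw [hHd]
    rfl
  · intro n hn _ e x hx
    obtain ⟨n, rfl⟩ : ∃ m, n = m + 1 := ⟨n - 1, by omega⟩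
    exact formalityMap_relation hh hhd hs hds hHd hε0 hs0
      (fun i j x hx y hy => (augmentation_mul hH hε0 hε hs0 hx hy).1)
      (fun i j x hx y hy => (augmentation_mul hH hε0 hε hs0 hx hy).2) n e x hx
  · have hm1 (y : B.carrier) : (B.toAnAlg N).m₁ y = B.d y := B.operations_one fun _ => y
    have hHm1 (y : H.carrier) : (H.toAnAlg N).m₁ y = 0 :=
      (H.operations_one fun _ => y).trans (by rw [hHd]; rfl)
    refine ⟨fun x _ hx => ⟨0, ?_⟩, fun y hy => ?_⟩
    · obtain ⟨y, hy⟩ := hx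
      refine (hHm1 0).trans (Eq.trans (Eq.symm ?_) (hqf x))
      exact (hq _).2 ⟨y, (hm1 y).symm.trans (hy.trans (hf1 x))⟩
    · have hy0 : B.d y = 0 := (hm1 y).symm.trans hy
      -- A cocycle minus the chosen representative of its class is a coboundary.
      obtain ⟨z, hz⟩ := (hq (⟨y, hy0⟩ - f (q ⟨y, hy0⟩))).1 (by rw [map_sub, hqf, sub_self])
      refine ⟨q ⟨y, hy0⟩, z, hHm1 _, ?_⟩
      have hy' : y = (f (q ⟨y, hy0⟩) : B.carrier) + B.d z := by
        rw [hz]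
        exact (add_sub_cancel (f (q ⟨y, hy0⟩) : B.carrier) y).symm
      exact hy'.trans (congrArg₂ (· + ·) (hf1 _).symm (hm1 z).symm)

variable (B)

/-- A differential graded algebra whose cohomology is concentrated in the degrees `0` and `1` and
consists of the scalars in degree `0` is formal. -/
theorem isFormal_of_isFreeType (hB : B.cohomology.IsFreeType) (N : ℕ∞) : B.IsFormal N := by
  obtain ⟨h, hh, hhd⟩ := B.exists_homotopy (hB.eq_zero 2 two_ne_zero (by decide))
  obtain ⟨s, hds, hs, hs0, hsc⟩ := B.exists_representatives
  exact isFormal_of_representatives (H := B.cohomology.withZeroDifferential) rfl hB hh hhd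
    (q := B.classMap.toLinearMap) (map_one B.classMap) B.classMap_eq_zero_iff hds hs hs0 hsc N

end DGAlg

/-! ### The cohomology of a free pro-`p` group, and the conclusion -/

section FreeProP

open DirectSum

/-- The cohomology of a free pro-`p` group consists of the scalars in degree `0` and vanishes in
degrees `≥ 2`. -/
theorem IsFreeProP.cohomology_isFreeType {p : ℕ} [Fact p.Prime] {G : Type u} [Group G]
    [TopologicalSpace G] [IsTopologicalGroup G] {X : Type v} {ι : X → G} (hG : IsFreeProP p ι) :
    (cochainAlgebra p G).cohomology.IsFreeType where
  one_ne_zero h := by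
    obtain ⟨y, hy⟩ := ((cochainAlgebra p G).classMap_eq_zero_iff 1).1 h
    have hy' : cochainD p G y = DirectSum.of (Cochain p G) 0 GradedMonoid.GOne.one := hy
    -- There are no nonzero coboundaries in degree 0, so the unit is not one.
    have h0 : ∀ z : ⨁ n, Cochain p G n, cochainD p G z 0 = 0 := by
      intro z
      induction z using DirectSum.induction_on with
      | zero => simp
      | of n φ =>
        rw [cochainD_of]
        exact DirectSum.of_eq_of_ne _ _ _ (by omega)
      | add x y hx hy => rw [map_add, DirectSum.add_apply, hx, hy, add_zero]
    have h1 := h0 y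
    rw [hy', DirectSum.of_eq_same] at h1
    exact one_ne_zero (congrArg (fun φ : Cochain p G 0 => φ Fin.elim0) h1)
  exists_smul_one := by
    rintro _ ⟨⟨x, hdx⟩, hx, rfl⟩
    have hx0 : x ∈ cochainGrading p G 0 := hx
    rcases mem_cochainGrading_iff.1 hx0 with rfl | ⟨n, φ, hn, rfl⟩
    · exact ⟨0, ((cochainAlgebra p G).classMap.map_zero).trans (zero_smul _ _).symm⟩
    · obtain rfl : n = 0 := by exact_mod_cast hn
      refine ⟨φ Fin.elim0, ?_⟩
      -- A 0-cochain is a function on the one-point space `G^0`, hence a constant.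
      have hφ : φ = φ Fin.elim0 • (GradedMonoid.GOne.one : Cochain p G 0) := by
        ext g
        rw [Subsingleton.elim g Fin.elim0]
        exact (mul_one _).symm
      have h2 : (⟨DirectSum.of (Cochain p G) 0 φ, hdx⟩ : (cochainAlgebra p G).cocycles) =
          φ Fin.elim0 • 1 := by
        refine Subtype.ext ?_
        change DirectSum.of (Cochain p G) 0 φ =
          φ Fin.elim0 • DirectSum.of (Cochain p G) 0 GradedMonoid.GOne.one
        conv_lhs => rw [hφ]
        exact (DirectSum.lof (ZMod p) ℕ (Cochain p G) 0).map_smul _ _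
      refine (congrArg (cochainAlgebra p G).classMap h2).trans ?_
      rw [map_smul, map_one]
      rfl
  eq_zero := by
    rintro i h0 h1 _ ⟨⟨x, hdx⟩, hx, rfl⟩
    have hx0 : x ∈ cochainGrading p G i := hx
    refine ((cochainAlgebra p G).classMap_eq_zero_iff _).2 ?_
    rcases mem_cochainGrading_iff.1 hx0 with rfl | ⟨n, φ, rfl, rfl⟩
    · exact ⟨0, map_zero _⟩
    · obtain ⟨n, rfl⟩ : ∃ m, n = m + 2 := ⟨n - 2, by omega⟩
      have hd : DirectSum.of (Cochain p G) (n + 2 + 1) (Cochain.δ (n + 2) φ) = 0 := by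
        rw [← cochainD_of]
        exact hdx
      obtain ⟨ψ, hψ⟩ := hG.exists_δ_eq (DirectSum.of_injective (β := Cochain p G) _
        (hd.trans (map_zero _).symm))
      refine ⟨DirectSum.of (Cochain p G) (n + 1) ψ, ?_⟩
      exact (cochainD_of ψ).trans (congrArg _ hψ)

end FreeProP

theorem proposition4p13 (p : ℕ) [Fact p.Prime]
    (G : Type u) [Group G] [TopologicalSpace G] [IsTopologicalGroup G]
    (X : Type v) (ι : X → G) (hG : IsFreeProP p ι) :
    (cochainAlgebra p G).cohomology.IsIntrinsicallyFormal.{0, u, w} ∧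
      (cochainAlgebra p G).IsFormal 3 :=
  ⟨fun B ⟨φ⟩ => B.isFormal_of_isFreeType (hG.cohomology_isFreeType.of_iso φ) ⊤,
    (cochainAlgebra p G).isFormal_of_isFreeType hG.cohomology_isFreeType 3⟩
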